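/- Let $M$ be a connected smooth ($C^\infty$) manifold of dimension $n\ge 3$, and let $A\subseteq TM\setminus\mathbf 0$ be open and conic ($\lambda v\in A$ for $v\in A$, $\lambda>0$) with $\pi(A)=M$. Write $\overline A$ for the closure of $A$ in $TM\setminus\mathbf 0$, $\partial A=\overline A\setminus A$, $(x,y)$ for natural coordinates on $TM$, $\partial_i=\partial/\partial x^i$, and a subscript $\cdot i$ for $\partial/\partial y^i$; repeated indices are summed. Let $L$ be a Lorentz–Finsler metric on $A$: a smooth function $L:A\to\mathbb R$ with $L(\lambda v)=\lambda^2L(v)$ for $\lambda>0$, such that $L>0$ on $A$, each $A_p=A\cap T_pM$ is connected, $g_{ij}=\tfrac12L_{\cdot i\cdot j}$ is non-degenerate of signature $(+,-,\dots,-)$, and $L$ extends smoothly to $\overline A$ with $L=0$ and $g$ non-degenerate on $\partial A$. Put $y_i=g_{ia}y^a$, and let $$\mathrm C_i=\tfrac12 g^{ab}g_{ab\cdot i},\qquad (\mathrm G^L)^i=\tfrac14 g^{ia}\left(2\partial_c g_{ab}-\partial_a g_{bc}\right)y^by^c,\qquad (\mathrm N^L)_i^k=(\mathrm G^L)^k_{\cdot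 i},$$ $$\mathrm{Lan}_i=\tfrac12\,g^{ab}\left(\partial_i g_{ab}-(\mathrm N^L)_i^c\,g_{ab\cdot c}-(\mathrm N^L)^c_{i\cdot a}\,g_{cb}-(\mathrm N^L)^c_{i\cdot b}\,g_{ac}\right)$$ be the mean Cartan tensor, the metric spray, the metric nonlinear connection and the mean Landsberg tensor. A homogeneous nonlinear connection $\mathrm N$ on $A$ (with smooth coefficients $\mathrm N_i^k(x,y)$, $1$-homogeneous in $y$, that under changes of chart satisfy $$\bar{\mathrm N}_i^k=\frac{\partial\bar x^k}{\partial x^c}\frac{\partial^2x^c}{\partial\bar x^i\partial\bar x^b}\bar y^b+\frac{\partial\bar x^k}{\partial x^c}\frac{\partial x^a}{\partial\bar x^i}\mathrm N_a^c\;)$$ is symmetric if $\mathrm N^k_{i\cdot j}=\mathrm N^k_{j\cdot i}$; it is a solution of the affine equation if $\mathcal J:=\mathrm N-\mathrm N^L$ satisfies, on $A$, $$\Big\{2\,\mathrm{Lan}_b+(n+2)\frac{y_a}{L}\mathcal J_b^a-2\,\mathrm C_a\mathcal J_b^a-\big(\mathcal J^a_{b\cdot a}+\mathcal J^a_{a\cdot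 b}\big)\Big\}\big(\delta_i^by^j-y^b\delta_i^j\big)-\big(\mathcal J^j_{i\cdot a}-\mathcal J^j_{a\cdot i}\big)y^a=0;$$ and such a solution is proper if $\mathrm N$ extends smoothly to $\overline A$. If $\mathrm C_i=0$ on $A$, then $\mathrm N^L$ is a symmetric proper solution of the affine equation, and it is the only one. -/

import Mathlib

open scoped Manifold ContDiff

noncomputable section

namespace FinslerAffine

/-! ### Calculus in natural coordinates

Natural coordinates of the tangent bundle are pairs `z = (x, y)` in `ℝⁿ × ℝⁿ`. -/

/-- The coordinate space `ℝⁿ`. -/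
abbrev E (n : ℕ) : Type := EuclideanSpace ℝ (Fin n)

/-- The `i`-th vector of the standard basis of `ℝⁿ`. -/
def e {n : ℕ} (i : Fin n) : E n := EuclideanSpace.single i 1

/-- `∂f/∂xⁱ`. -/
def dx {n : ℕ} (i : Fin n) (f : E n × E n → ℝ) : E n × E n → ℝ :=
  fun z => fderiv ℝ f z (e i, 0)

/-- The vertical derivative `∂f/∂yⁱ`, which is written `f_{·i}`. -/
def dy {n : ℕ} (i : Fin n) (f : E n × E n → ℝ) : E n × E n → ℝ :=
  fun z => fderiv ℝ f z (0, e i)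

/-- The fundamental tensor `g_{ij} = ½ L_{·i·j}`. -/
def g {n : ℕ} (L : E n × E n → ℝ) (i j : Fin n) : E n × E n → ℝ :=
  fun z => (1 / 2 : ℝ) * dy j (dy i L) z

/-- The matrix `(g_{ij})` at a point. -/
def gMat {n : ℕ} (L : E n × E n → ℝ) (z : E n × E n) : Matrix (Fin n) (Fin n) ℝ :=
  Matrix.of fun i j => g L i j z

/-- The inverse metric `g^{ij}`. -/
def gInv {n : ℕ} (L : E n × E n → ℝ) (i j : Fin n) : E n × E n → ℝ :=
  fun z => (gMat L z)⁻¹ i j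

/-- `y_i = g_{ia} y^a`. -/
def yLow {n : ℕ} (L : E n × E n → ℝ) (i : Fin n) : E n × E n → ℝ :=
  fun z => ∑ a, g L i a z * z.2 a

/-- The coefficients of the metric spray,
`G^i = ¼ g^{ia} (2 ∂_c g_{ab} - ∂_a g_{bc}) y^b y^c`. -/
def metricSpray {n : ℕ} (L : E n × E n → ℝ) (i : Fin n) : E n × E n → ℝ :=
  fun z => (1 / 4 : ℝ) * ∑ a, ∑ b, ∑ c,
    gInv L i a z * (2 * dx c (g L a b) z - dx a (g L b c) z) * z.2 b * z.2 c

/-- The coefficients `N_i^k = G^k_{·i}` of the metric nonlinear connection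
(lower index first). -/
def metricN {n : ℕ} (L : E n × E n → ℝ) (i k : Fin n) : E n × E n → ℝ :=
  dy i (metricSpray L k)

/-- The Cartan tensor `C_{ijk} = ½ g_{ij·k}`. -/
def cartan {n : ℕ} (L : E n × E n → ℝ) (i j k : Fin n) : E n × E n → ℝ :=
  fun z => (1 / 2 : ℝ) * dy k (g L i j) z

/-- The mean Cartan tensor `C_i = g^{ab} C_{abi}`. -/
def meanCartan {n : ℕ} (L : E n × E n → ℝ) (i : Fin n) : E n × E n → ℝ :=
  fun z => ∑ a, ∑ b, gInv L a b z * cartan L a b i z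

/-- The horizontal derivative `δ_i f = ∂f/∂xⁱ - N_i^a ∂f/∂y^a`. -/
def horiz {n : ℕ} (N : Fin n → Fin n → E n × E n → ℝ) (i : Fin n) (f : E n × E n → ℝ) :
    E n × E n → ℝ :=
  fun z => dx i f z - ∑ a, N i a z * dy a f z

/-- The Landsberg tensor `Lan_{ijk} = ½ ∇_k g_{ij}`, where `∇` is the covariant derivative of the
Berwald anisotropic connection `Γ_{ij}^k = N_{i·j}^k` of the metric nonlinear connection. -/
def landsberg {n : ℕ} (L : E n × E n → ℝ) (i j k : Fin n) : E n × E n → ℝ :=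
  fun z => (1 / 2 : ℝ) * (horiz (metricN L) k (g L i j) z
    - ∑ a, dy i (metricN L k a) z * g L a j z
    - ∑ a, dy j (metricN L k a) z * g L i a z)

/-- The mean Landsberg tensor `Lan_i = g^{ab} Lan_{abi}`. -/
def meanLandsberg {n : ℕ} (L : E n × E n → ℝ) (i : Fin n) : E n × E n → ℝ :=
  fun z => ∑ a, ∑ b, gInv L a b z * landsberg L a b i z

/-- The Kronecker delta. -/
def kron {n : ℕ} (i j : Fin n) : ℝ := if i = j then 1 else 0

/-- The expression in braces in the affine equation,
`2 Lan_b + (n+2) (y_a/L) J_b^a - 2 C_a J_b^a - (J_{b·a}^a + J_{a·b}^a)`. -/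
def affineCovector {n : ℕ} (L : E n × E n → ℝ) (J : Fin n → Fin n → E n × E n → ℝ)
    (b : Fin n) : E n × E n → ℝ :=
  fun z => 2 * meanLandsberg L b z
    + ((n : ℝ) + 2) * ∑ a, yLow L a z / L z * J b a z
    - 2 * ∑ a, meanCartan L a z * J b a z
    - ∑ a, (dy a (J b a) z + dy b (J a a) z)

/-- The left-hand side of the affine equation (lower index `i`, upper index `j`),
`{…}_b (δ_i^b y^j - y^b δ_i^j) - (J_{i·a}^j - J_{a·i}^j) y^a`. -/
def affineLHS {n : ℕ} (L : E n × E n → ℝ) (J : Fin n → Fin n → E n × E n → ℝ)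
    (i j : Fin n) : E n × E n → ℝ :=
  fun z => ∑ b, affineCovector L J b z * (kron i b * z.2 j - z.2 b * kron i j)
    - ∑ a, (dy a (J i j) z - dy i (J a j) z) * z.2 a

/-- A real symmetric matrix of Lorentzian signature `(+,-,…,-)`: in some basis it is
`diag(-1,…,1,…,-1)` with exactly one entry `1`. -/
def IsLorentzian {n : ℕ} (G : Matrix (Fin n) (Fin n) ℝ) : Prop :=
  ∃ P : Matrix (Fin n) (Fin n) ℝ, IsUnit P.det ∧
    ∃ k : Fin n, P.transpose * G * P = Matrix.diagonal fun i => if i = k then (1 : ℝ) else -1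

/-! ### Charts, conic domains -/

section Manifold

variable {n : ℕ} {M : Type*} [TopologicalSpace M] [ChartedSpace (E n) M]

/-- The tangent bundle `TM`. -/
abbrev TM (n : ℕ) (M : Type*) [TopologicalSpace M] [ChartedSpace (E n) M]
    [IsManifold (𝓡 n) ∞ M] : Type _ := TangentBundle (𝓡 n) M

/-- The charts of the smooth manifold `M`, i.e. of its maximal atlas. -/
abbrev Chart (n : ℕ) (M : Type*) [TopologicalSpace M] [ChartedSpace (E n) M] : Type _ :=
  {φ : OpenPartialHomeomorph M (E n) // φ ∈ IsManifold.maximalAtlas (𝓡 n) ∞ M}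

variable [IsManifold (𝓡 n) ∞ M]

/-- The natural coordinates `(x, y)` of a tangent vector based in the domain of `φ`. -/
def toCoord (φ : Chart n M) (v : TM n M) : E n × E n :=
  (φ.1 v.1, mfderiv (𝓡 n) (𝓡 n) φ.1 v.1 v.2)

/-- The tangent vector of natural coordinates `z = (x, y)`. -/
def ofCoord (φ : Chart n M) (z : E n × E n) : TM n M :=
  ⟨φ.1.symm z.1, mfderiv (𝓡 n) (𝓡 n) φ.1.symm z.1 z.2⟩

/-- `A ∩ TU` in the natural coordinates of the chart `(U, φ)`. -/
def coordDom (φ : Chart n M) (A : Set (TM n M)) : Set (E n × E n) :=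
  {z | z.1 ∈ φ.1.target ∧ ofCoord φ z ∈ A}

/-- The expression of a function on `TM` in natural coordinates. -/
def inCoord (φ : Chart n M) (L : TM n M → ℝ) : E n × E n → ℝ :=
  fun z => L (ofCoord φ z)

/-- The homothety `v ↦ t v` of the fibres of `TM`. -/
def scale (t : ℝ) (v : TM n M) : TM n M := ⟨v.1, t • v.2⟩

/-- `TM` without the zero section. -/
def slit (n : ℕ) (M : Type*) [TopologicalSpace M] [ChartedSpace (E n) M]
    [IsManifold (𝓡 n) ∞ M] : Set (TM n M) := {v | v.2 ≠ 0}

/-- The closure of `A` in `TM ∖ 0`. -/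
def slitClosure (A : Set (TM n M)) : Set (TM n M) := closure A ∩ slit n M

/-- An open conic subset of `TM ∖ 0` projecting onto `M`. -/
structure IsConicDomain (A : Set (TM n M)) : Prop where
  isOpen : IsOpen A
  subset_slit : A ⊆ slit n M
  scale_mem : ∀ v ∈ A, ∀ t : ℝ, 0 < t → scale t v ∈ A
  onto : ∀ p : M, ∃ v ∈ A, v.1 = p

/-! ### Pseudo-Finsler metrics

Only the values on `A` of the function `L` are relevant. -/

/-- `L` is a (conic) pseudo-Finsler metric on `A`. -/
structure IsPseudoFinsler (A : Set (TM n M)) (L : TM n M → ℝ) : Prop where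
  domain : IsConicDomain A
  smooth : ContMDiffOn (𝓡 n).tangent 𝓘(ℝ, ℝ) ∞ L A
  homogeneous : ∀ v ∈ A, ∀ t : ℝ, 0 < t → L (scale t v) = t ^ 2 * L v
  nondegenerate : ∀ (φ : Chart n M), ∀ z ∈ coordDom φ A, (gMat (inCoord φ L) z).det ≠ 0

/-- `L` is proper: the fibres of `A` are connected, `L > 0` on `A`, and `L` extends smoothly to the
closure of `A` in `TM ∖ 0`, with `L = 0` and `g` non-degenerate on the boundary. A smooth extension
to a boundary point is a smooth function on a neighbourhood of it which equals `L` on `A`; its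
derivatives at the boundary point are determined by `L`. -/
structure IsProper (A : Set (TM n M)) (L : TM n M → ℝ) : Prop extends IsPseudoFinsler A L where
  connected : ∀ p : M, IsConnected {w : TangentSpace (𝓡 n) p | (⟨p, w⟩ : TM n M) ∈ A}
  pos : ∀ v ∈ A, 0 < L v
  boundary : ∀ v ∈ slitClosure A \ A, ∃ (U : Set (TM n M)) (L' : TM n M → ℝ),
    IsOpen U ∧ v ∈ U ∧ ContMDiffOn (𝓡 n).tangent 𝓘(ℝ, ℝ) ∞ L' U ∧ Set.EqOn L' L (U ∩ A) ∧
    L' v = 0 ∧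
    ∀ φ : Chart n M, v.1 ∈ φ.1.source → (gMat (inCoord φ L') (toCoord φ v)).det ≠ 0

/-- `L` is (properly) Lorentz-Finsler: it is proper and its fundamental tensor has signature
`(+,-,…,-)`. (As `g` is non-degenerate on the closure of `A`, its signature at a boundary point is
the one at the nearby points of `A`.) -/
structure IsLorentzFinsler (A : Set (TM n M)) (L : TM n M → ℝ) : Prop extends IsProper A L where
  lorentzian : ∀ (φ : Chart n M), ∀ z ∈ coordDom φ A, IsLorentzian (gMat (inCoord φ L) z)

/-- The mean Cartan tensor of `L` vanishes on `A`. -/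
def MeanCartanVanishes (A : Set (TM n M)) (L : TM n M → ℝ) : Prop :=
  ∀ (φ : Chart n M), ∀ z ∈ coordDom φ A, ∀ i, meanCartan (inCoord φ L) i z = 0

/-! ### Nonlinear connections -/

/-- The change of coordinates `φ ∘ ψ⁻¹`. -/
def transition (φ ψ : Chart n M) : E n → E n := fun x => φ.1 (ψ.1.symm x)

/-- A (smooth) homogeneous nonlinear connection for `A → M`, given by its coefficients `N_i^k`
(lower index first) in each chart, `1`-homogeneous, and transforming by
`N̄_i^k = (∂x̄^k/∂x^c) (∂²x^c/∂x̄^i∂x̄^b) ȳ^b + (∂x̄^k/∂x^c) (∂x^a/∂x̄^i) N_a^c`.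
The coefficients are functions on `A`; off `A` they are given the value `0`, so that connections
that agree on `A` are equal. -/
@[ext]
structure NonlinearConnection (A : Set (TM n M)) where
  coeff : Chart n M → Fin n → Fin n → E n × E n → ℝ
  smooth : ∀ φ i k, ContDiffOn ℝ ∞ (coeff φ i k) (coordDom φ A)
  homogeneous : ∀ φ i k, ∀ z ∈ coordDom φ A, ∀ t : ℝ, 0 < t →
    coeff φ i k (z.1, t • z.2) = t * coeff φ i k z
  cocycle : ∀ φ ψ : Chart n M, ∀ z ∈ coordDom ψ A, ψ.1.symm z.1 ∈ φ.1.source → ∀ i k,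
    coeff ψ i k z =
      ∑ c, fderiv ℝ (transition ψ φ) (transition φ ψ z.1) (e c) k *
        (∑ b, fderiv ℝ (fun x => fderiv ℝ (transition φ ψ) x (e b) c) z.1 (e i) * z.2 b
          + ∑ a, fderiv ℝ (transition φ ψ) z.1 (e i) a *
              coeff φ a c (transition φ ψ z.1, fderiv ℝ (transition φ ψ) z.1 z.2))
  off : ∀ φ i k, ∀ z ∉ coordDom φ A, coeff φ i k z = 0

namespace NonlinearConnection

variable {A : Set (TM n M)}

/-- `N` is the metric nonlinear connection `N^L`, that is, `N_i^k = (G^L)^k_{·i}` on `A`. -/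
def IsMetric (N : NonlinearConnection A) (L : TM n M → ℝ) : Prop :=
  ∀ (φ : Chart n M), ∀ z ∈ coordDom φ A, ∀ i k, N.coeff φ i k z = metricN (inCoord φ L) i k z

/-- `N` is symmetric: its torsion `Tor_{ij}^k = N_{i·j}^k - N_{j·i}^k` vanishes. -/
def IsSymmetric (N : NonlinearConnection A) : Prop :=
  ∀ (φ : Chart n M), ∀ z ∈ coordDom φ A, ∀ i j k,
    dy j (N.coeff φ i k) z - dy i (N.coeff φ j k) z = 0

/-- The coordinates of `J = N - N^L`. -/
def diffMetric (N : NonlinearConnection A) (L : TM n M → ℝ) (φ : Chart n M) (i k : Fin n) :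
    E n × E n → ℝ :=
  fun z => N.coeff φ i k z - metricN (inCoord φ L) i k z

/-- `N` solves the affine equation on `A`. -/
def IsSolution (N : NonlinearConnection A) (L : TM n M → ℝ) : Prop :=
  ∀ (φ : Chart n M), ∀ z ∈ coordDom φ A, ∀ i j,
    affineLHS (inCoord φ L) (N.diffMetric L φ) i j z = 0

/-- `N` extends smoothly to the closure of `A` in `TM ∖ 0`: near each of its points, the
coefficients are the restrictions to `A` of smooth functions on a neighbourhood. -/
def ExtendsSmoothly (N : NonlinearConnection A) : Prop :=
  ∀ (φ : Chart n M), ∀ v ∈ slitClosure A, v.1 ∈ φ.1.source → ∀ i k,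
    ∃ (U : Set (E n × E n)) (f : E n × E n → ℝ), IsOpen U ∧ toCoord φ v ∈ U ∧
      ContDiffOn ℝ ∞ f U ∧ Set.EqOn f (N.coeff φ i k) (U ∩ coordDom φ A)

end NonlinearConnection

/-- `Sol^Sym_L(A)`: the symmetric solutions of the affine equation. -/
def SolSym (A : Set (TM n M)) (L : TM n M → ℝ) : Set (NonlinearConnection A) :=
  {N | N.IsSolution L ∧ N.IsSymmetric}

/-- `Sol_L(Ā)`: the proper solutions of the affine equation. -/
def SolProper (A : Set (TM n M)) (L : TM n M → ℝ) : Set (NonlinearConnection A) :=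
  {N | N.IsSolution L ∧ N.ExtendsSmoothly}

end Manifold

end FinslerAffine

end

/-! Existence. `C_i` is half the vertical derivative of `log |det g|`, so `C = 0` makes `τ_i = ∂_i
log |det g|` independent of `y`. Differentiating the defining relation of the spray gives `N_a^a = ½
y^c τ_c` for `N = N^L`, hence `N^a_{i·a} = ½ τ_i`, and the mean Landsberg tensor vanishes
(`meanLandsberg_eq_zero`). Then `J = 0` solves the affine equation. The metric connection is given
by smooth formulas in `L` and `g⁻¹`, so it extends wherever `L` extends with `g` nondegenerate. It
is a connection because the spray is characterised by the Euler–Lagrange equations of `L`, which are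
invariant under changes of chart.

Uniqueness. For symmetric `J` the affine equation says that the covector in braces is zero. With `f
= J_a^a` and `S^a = J_i^a y^i`, so that `S^a_{·b} = 2 J_b^a`, this becomes `(n+2) y_a J_b^a = 2 L
f_{·b}`. Contracting with `y`, differentiating and raising an index gives `(n+2) S^a = 4 f y^a - 2 L
g^{ab} f_{·b}` (`sum_J_eq`): the trace `f` determines `J`. The vertical divergence of this identity,
with `g^{ab}_{·a} = 0`, is the scalar equation `L g^{ab} f_{·a·b} = (n-2) f` (`mul_vertLap_trace`).

It remains to show `f = 0` on each fibre. Smoothness up to the boundary and `n ≥ 3` allow writing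
`f² / L = L (g^{ab} f_{·a·b})² / (n-2)²`, which tends to `0` where `L` does
(`tendsto_sq_div_of_extension`). So the `0`-homogeneous function `f² / L`, extended by zero, attains
a maximum `m` on the unit sphere. If `m > 0`, the maximum is interior, and `w = m L - f²` has there
a positive semidefinite vertical Hessian that annihilates the timelike vector `y`. Such a form lives
on the spacelike directions, so its trace with respect to the Lorentzian `g` is nonpositive
(`IsLorentzian.trace_nonpos`); but the scalar equation evaluates this trace to `2 m > 0`
(`eq_zero_of_isMax`). -/

namespace FinslerAffine

/-! ### Directional derivatives -/

section Directional

variable {n : ℕ}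

/-- The derivative of `f` in the constant direction `v`; `dx` and `dy` are special cases. -/
noncomputable def dir (v : E n × E n) (f : E n × E n → ℝ) : E n × E n → ℝ :=
  fun z => fderiv ℝ f z v

theorem dx_eq_dir (i : Fin n) (f : E n × E n → ℝ) : dx i f = dir (e i, 0) f := rfl

theorem dy_eq_dir (i : Fin n) (f : E n × E n → ℝ) : dy i f = dir (0, e i) f := rfl

variable {f h : E n × E n → ℝ} {z : E n × E n} (v w : E n × E n)

theorem dir_contDiffAt (hf : ContDiffAt ℝ ∞ f z) : ContDiffAt ℝ ∞ (dir v f) z :=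
  (hf.fderiv_right (m := ∞) (by simp)).clm_apply contDiffAt_const

theorem dx_contDiffAt (i : Fin n) (hf : ContDiffAt ℝ ∞ f z) : ContDiffAt ℝ ∞ (dx i f) z :=
  dir_contDiffAt _ hf

theorem dy_contDiffAt (i : Fin n) (hf : ContDiffAt ℝ ∞ f z) : ContDiffAt ℝ ∞ (dy i f) z :=
  dir_contDiffAt _ hf

theorem differentiableAt_of_smooth (hf : ContDiffAt ℝ ∞ f z) : DifferentiableAt ℝ f z :=
  hf.differentiableAt (by simp)

theorem dir_congr (hfh : f =ᶠ[nhds z] h) : dir v f z = dir v h z := by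
  unfold dir; rw [hfh.fderiv_eq]

theorem dir_comm (hf : ContDiffAt ℝ ∞ f z) : dir v (dir w f) z = dir w (dir v f) z := by
  have hd : DifferentiableAt ℝ (fderiv ℝ f) z :=
    (hf.fderiv_right (m := ∞) (by simp)).differentiableAt (by simp)
  have key : ∀ a b : E n × E n, dir a (dir b f) z = fderiv ℝ (fderiv ℝ f) z a b := by
    intro a b
    unfold dir
    rw [fderiv_clm_apply hd (differentiableAt_const b)]
    simp
  rw [key, key]
  have h2 : minSmoothness ℝ 2 ≤ (∞ : ℕ∞ω) := by
    rw [minSmoothness_of_isRCLikeNormedField]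
    exact WithTop.coe_le_coe.2 (le_top : (2 : ℕ∞) ≤ ⊤)
  exact (hf.isSymmSndFDerivAt h2).eq v w

theorem dir_dir_eq (hf : ContDiffAt ℝ ∞ f z) :
    dir v (dir w f) z = fderiv ℝ (fderiv ℝ f) z v w := by
  have hd : DifferentiableAt ℝ (fderiv ℝ f) z :=
    (hf.fderiv_right (m := ∞) (by simp)).differentiableAt (by simp)
  unfold dir
  rw [fderiv_clm_apply hd (differentiableAt_const w)]
  simp

theorem dir_const (c : ℝ) : dir v (fun _ : E n × E n => c) z = 0 := by simp [dir]

theorem dir_sub (hf : DifferentiableAt ℝ f z) (hh : DifferentiableAt ℝ h z) :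
    dir v (fun z => f z - h z) z = dir v f z - dir v h z := by
  unfold dir; rw [fderiv_fun_sub hf hh]; rfl

theorem dir_mul (hf : DifferentiableAt ℝ f z) (hh : DifferentiableAt ℝ h z) :
    dir v (fun z => f z * h z) z = dir v f z * h z + f z * dir v h z := by
  unfold dir; rw [fderiv_fun_mul hf hh]; simp; ring

theorem dir_const_mul (c : ℝ) (hf : DifferentiableAt ℝ f z) :
    dir v (fun z => c * f z) z = c * dir v f z := by
  unfold dir; rw [fderiv_const_mul hf]; simp

theorem dir_sum {ι : Type*} (s : Finset ι) {F : ι → E n × E n → ℝ}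
    (hF : ∀ i ∈ s, DifferentiableAt ℝ (F i) z) :
    dir v (fun z => ∑ i ∈ s, F i z) z = ∑ i ∈ s, dir v (F i) z := by
  unfold dir; rw [fderiv_fun_sum hF]; simp

theorem dir_sum_mul {ι : Type*} (s : Finset ι) {F H : ι → E n × E n → ℝ}
    (hF : ∀ i, DifferentiableAt ℝ (F i) z) (hH : ∀ i, DifferentiableAt ℝ (H i) z) :
    dir v (fun z => ∑ i ∈ s, F i z * H i z) z
      = ∑ i ∈ s, (dir v (F i) z * H i z + F i z * dir v (H i) z) := by
  rw [dir_sum (F := fun i z => F i z * H i z) v s fun i _ => (hF i).mul (hH i)]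
  exact Finset.sum_congr rfl fun i _ => dir_mul v (hF i) (hH i)

theorem smooth_snd (a : Fin n) (z : E n × E n) :
    ContDiffAt ℝ ∞ (fun z : E n × E n => z.2 a) z := by
  have : (fun z : E n × E n => z.2 a) =
      ((EuclideanSpace.proj a : E n →L[ℝ] ℝ).comp (ContinuousLinearMap.snd ℝ (E n) (E n))) := by
    ext; rfl
  rw [this]
  exact ContinuousLinearMap.contDiff _ |>.contDiffAt

theorem dir_snd (a : Fin n) : dir v (fun z : E n × E n => z.2 a) z = v.2 a := by
  have : (fun z : E n × E n => z.2 a) =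
      ((EuclideanSpace.proj a : E n →L[ℝ] ℝ).comp (ContinuousLinearMap.snd ℝ (E n) (E n))) := by
    ext; rfl
  unfold dir
  rw [this, ContinuousLinearMap.fderiv]
  rfl

theorem e_apply (i j : Fin n) : (e i : E n) j = if j = i then 1 else 0 := by
  simp [e]

theorem sum_smul_e (w : E n) : ∑ i, w i • (e i : E n) = w := by
  ext j
  simp [e_apply]

theorem sum_mul_dy (f : E n × E n → ℝ) (z : E n × E n) (w : E n) :
    ∑ i, w i * dy i f z = dir (0, w) f z := by
  unfold dy dir
  conv_rhs => rw [← sum_smul_e w]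
  have : ((0 : E n), ∑ i, w i • (e i : E n)) = ∑ i, w i • ((0 : E n), (e i : E n)) := by
    ext <;> simp [Prod.fst_sum, Prod.snd_sum]
  rw [this, map_sum]
  simp only [map_smul, smul_eq_mul]

theorem sum_mul_dx (f : E n × E n → ℝ) (z : E n × E n) (w : E n) :
    ∑ i, w i * dx i f z = dir (w, 0) f z := by
  unfold dx dir
  conv_rhs => rw [← sum_smul_e w]
  have : (∑ i, w i • (e i : E n), (0 : E n)) = ∑ i, w i • ((e i : E n), (0 : E n)) := by
    ext <;> simp [Prod.fst_sum, Prod.snd_sum]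
  rw [this, map_sum]
  simp only [map_smul, smul_eq_mul]

end Directional

/-! ### Homogeneous functions on conic domains -/

section Homogeneous

variable {n : ℕ} {D : Set (E n × E n)} {f : E n × E n → ℝ} {k : ℕ}

/-- An open subset of `ℝⁿ × (ℝⁿ ∖ 0)` that is conic in the second variable. -/
structure IsOpenCone (D : Set (E n × E n)) : Prop where
  isOpen : IsOpen D
  smul_mem : ∀ z ∈ D, ∀ t : ℝ, 0 < t → (z.1, t • z.2) ∈ D
  ne_zero : ∀ z ∈ D, z.2 ≠ 0

/-- Positive `k`-homogeneity in the second variable. -/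
def HomogOn (D : Set (E n × E n)) (k : ℕ) (f : E n × E n → ℝ) : Prop :=
  ∀ z ∈ D, ∀ t : ℝ, 0 < t → f (z.1, t • z.2) = t ^ k * f z

/-- The linear homothety `(x, y) ↦ (x, t y)`. -/
noncomputable def homothety (n : ℕ) (t : ℝ) : E n × E n →L[ℝ] E n × E n :=
  (ContinuousLinearMap.fst ℝ (E n) (E n)).prod (t • ContinuousLinearMap.snd ℝ (E n) (E n))

theorem homothety_apply (t : ℝ) (z : E n × E n) : homothety n t z = (z.1, t • z.2) := rfl

/-- Chain rule for `f ∘ h_t = t ^ k f`. The homothety fixes horizontal directions and multiplies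
vertical ones by `t`, so `∂/∂x` keeps the degree of homogeneity and `∂/∂y` lowers it by one. -/
theorem HomogOn.dir_homothety (hD : IsOpenCone D) (hf : HomogOn D k f)
    (hs : ∀ z ∈ D, ContDiffAt ℝ ∞ f z) {z : E n × E n} (hz : z ∈ D) {t : ℝ} (ht : 0 < t)
    (v : E n × E n) :
    dir (homothety n t v) f (z.1, t • z.2) = t ^ k * dir v f z := by
  have h1 : (fun z => f (homothety n t z)) =ᶠ[nhds z] fun z => t ^ k * f z := by
    filter_upwards [hD.isOpen.mem_nhds hz] with x hx using hf x hx t ht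
  have h2 := dir_congr v h1
  rw [dir_const_mul _ _ (differentiableAt_of_smooth (hs z hz))] at h2
  rw [← h2]
  have hd : DifferentiableAt ℝ f (homothety n t z) :=
    differentiableAt_of_smooth (hs _ (hD.smul_mem z hz t ht))
  unfold dir
  have := fderiv_comp (𝕜 := ℝ) z hd (homothety n t).differentiableAt
  change _ = fderiv ℝ (f ∘ homothety n t) z v
  rw [this, ContinuousLinearMap.fderiv]
  rfl

theorem HomogOn.dx (hD : IsOpenCone D) (hf : HomogOn D k f)
    (hs : ∀ z ∈ D, ContDiffAt ℝ ∞ f z) (i : Fin n) : HomogOn D k (dx i f) := by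
  intro z hz t ht
  have := hf.dir_homothety hD hs hz ht (e i, 0)
  simpa [homothety_apply, dx_eq_dir] using this

theorem HomogOn.dy (hD : IsOpenCone D) (hf : HomogOn D (k + 1) f)
    (hs : ∀ z ∈ D, ContDiffAt ℝ ∞ f z) (i : Fin n) : HomogOn D k (dy i f) := by
  intro z hz t ht
  have := hf.dir_homothety hD hs hz ht (0, e i)
  have h2 : homothety n t (0, e i) = t • ((0 : E n), (e i : E n)) := by
    simp [homothety_apply]
  rw [h2] at this
  have h3 : dir (t • ((0 : E n), (e i : E n))) f (z.1, t • z.2)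
      = t * dir (0, e i) f (z.1, t • z.2) := by
    unfold dir; rw [map_smul, smul_eq_mul]
  rw [h3, pow_succ'] at this
  rw [dy_eq_dir]
  have ht' := ht.ne'
  apply mul_left_cancel₀ ht'
  rw [this]; ring

theorem HomogOn.euler (hf : HomogOn D k f)
    (hs : ∀ z ∈ D, ContDiffAt ℝ ∞ f z) {z : E n × E n} (hz : z ∈ D) :
    ∑ i, z.2 i * FinslerAffine.dy i f z = k * f z := by
  rw [sum_mul_dy]
  have hd : HasFDerivAt f (fderiv ℝ f z) ((fun t : ℝ => (z.1, t • z.2)) 1) := by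
    simpa using (differentiableAt_of_smooth (hs z hz)).hasFDerivAt
  have hc : HasDerivAt (fun t : ℝ => (z.1, t • z.2)) ((0 : E n), z.2) 1 := by
    have := ((hasDerivAt_id (1 : ℝ)).smul_const z.2)
    simpa using (hasDerivAt_const (1 : ℝ) z.1).prodMk this
  have h1 := hd.comp_hasDerivAt (1 : ℝ) hc
  have h2 : HasDerivAt (fun t : ℝ => t ^ k * f z) ((k * 1 ^ (k - 1)) * f z) 1 :=
    (hasDerivAt_pow k 1).mul_const _
  have h3 : (f ∘ fun t : ℝ => (z.1, t • z.2)) =ᶠ[nhds 1] fun t : ℝ => t ^ k * f z := by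
    filter_upwards [lt_mem_nhds (zero_lt_one : (0 : ℝ) < 1)] with t ht using hf z hz t ht
  have := h1.unique (h2.congr_of_eventuallyEq h3)
  simpa [dir] using this

end Homogeneous

/-! ### The fundamental tensor and its inverse -/

section Tensor

variable {n : ℕ} {L : E n × E n → ℝ} {z : E n × E n}

theorem g_smooth (hL : ContDiffAt ℝ ∞ L z) (i j : Fin n) : ContDiffAt ℝ ∞ (g L i j) z :=
  contDiffAt_const.mul (dy_contDiffAt j (dy_contDiffAt i hL))

theorem g_symm (hL : ContDiffAt ℝ ∞ L z) (i j : Fin n) : g L i j z = g L j i z := by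
  unfold g
  rw [dy_eq_dir, dy_eq_dir, dy_eq_dir, dy_eq_dir, dir_comm _ _ hL]

/-- Differentiating `g` requires its symmetry near `z`. Smoothness of order `∞` at a point yields
only finite orders on neighbourhoods; order `2` suffices here. -/
theorem g_eventually_symm (hL : ContDiffAt ℝ ∞ L z) (i j : Fin n) :
    g L i j =ᶠ[nhds z] g L j i := by
  have h : dir (0, e j) (dir (0, e i) L) =ᶠ[nhds z] dir (0, e i) (dir (0, e j) L) := by
    have h2 := (hL.of_le (m := 2) (by exact WithTop.coe_le_coe.2 (le_top : (2 : ℕ∞) ≤ ⊤))).eventually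
      (by simp)
    filter_upwards [h2] with x hx
    have hd : DifferentiableAt ℝ (fderiv ℝ L) x :=
      (hx.fderiv_right (m := 1) (by norm_num)).differentiableAt (by simp)
    unfold dir
    rw [fderiv_clm_apply hd (differentiableAt_const _),
      fderiv_clm_apply hd (differentiableAt_const _)]
    simpa using (hx.isSymmSndFDerivAt (by simp)).eq _ _
  filter_upwards [h] with x hx
  unfold g
  rw [dy_eq_dir, dy_eq_dir, dy_eq_dir, dy_eq_dir, hx]

theorem dir_g (hL : ContDiffAt ℝ ∞ L z) (v : E n × E n) (i j : Fin n) :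
    dir v (g L i j) z = 1 / 2 * dir v (dy j (dy i L)) z :=
  dir_const_mul _ _ (differentiableAt_of_smooth (dy_contDiffAt j (dy_contDiffAt i hL)))

/-- Together with the symmetry of `g`, this is the total symmetry of the Cartan tensor, a third
vertical derivative of `L`. It lets any trace of `g_{ij·k}` be read as the mean Cartan tensor. -/
theorem dy_g_swap (hL : ContDiffAt ℝ ∞ L z) (i j k : Fin n) :
    dy k (g L i j) z = dy j (g L i k) z := by
  simp only [dy_eq_dir, dir_g hL]
  rw [dir_comm _ _ (dir_contDiffAt _ hL)]

theorem det_smooth {ι : Type*} [Fintype ι] [DecidableEq ι] {F : E n × E n → Matrix ι ι ℝ}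
    (hF : ∀ i j, ContDiffAt ℝ ∞ (fun z => F z i j) z) :
    ContDiffAt ℝ ∞ (fun z => (F z).det) z := by
  simp only [Matrix.det_apply]
  refine ContDiffAt.sum fun σ _ => ?_
  exact (contDiffAt_prod fun i _ => hF _ _).const_smul _

theorem gInv_smooth (hL : ContDiffAt ℝ ∞ L z) (hz : (gMat L z).det ≠ 0) (i j : Fin n) :
    ContDiffAt ℝ ∞ (gInv L i j) z := by
  have hG : ∀ i j, ContDiffAt ℝ ∞ (fun z => gMat L z i j) z := fun i j => g_smooth hL i j
  have h : gInv L i j = fun z => ((gMat L z).det)⁻¹ * (gMat L z).adjugate i j := by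
    funext x
    simp [gInv, Matrix.inv_def]
  rw [h]
  refine ((det_smooth hG).inv hz).mul ?_
  simp only [Matrix.adjugate_apply]
  refine det_smooth fun a b => ?_
  simp only [Matrix.updateRow_apply]
  split_ifs
  · exact contDiffAt_const
  · exact hG a b

theorem det_eventually_ne (hL : ContDiffAt ℝ ∞ L z) (hz : (gMat L z).det ≠ 0) :
    ∀ᶠ x in nhds z, (gMat L x).det ≠ 0 :=
  (det_smooth (F := gMat L) fun i j => g_smooth hL i j).continuousAt.eventually_ne hz

theorem gMat_transpose (hL : ContDiffAt ℝ ∞ L z) : (gMat L z).transpose = gMat L z := by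
  ext i j; exact g_symm hL j i

theorem gInv_symm (hL : ContDiffAt ℝ ∞ L z) (i j : Fin n) : gInv L i j z = gInv L j i z := by
  have h := Matrix.transpose_nonsing_inv (gMat L z)
  rw [gMat_transpose hL] at h
  exact congrFun (congrFun h j) i

theorem sum_gInv_mul_g (hz : (gMat L z).det ≠ 0) (i j : Fin n) :
    ∑ a, gInv L i a z * g L a j z = if i = j then 1 else 0 := by
  have := congrFun (congrFun (Matrix.nonsing_inv_mul (gMat L z) (isUnit_iff_ne_zero.2 hz)) i) j
  rw [Matrix.mul_apply, Matrix.one_apply] at this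
  exact this

theorem sum_g_mul_gInv (hz : (gMat L z).det ≠ 0) (i j : Fin n) :
    ∑ a, g L i a z * gInv L a j z = if i = j then 1 else 0 := by
  have := congrFun (congrFun (Matrix.mul_nonsing_inv (gMat L z) (isUnit_iff_ne_zero.2 hz)) i) j
  rw [Matrix.mul_apply, Matrix.one_apply] at this
  exact this

/-- Raising an index. -/
theorem eq_sum_gInv_of_sum_g (hz : (gMat L z).det ≠ 0) {u w : Fin n → ℝ}
    (h : ∀ i, ∑ a, g L i a z * u a = w i) (i : Fin n) : u i = ∑ a, gInv L i a z * w a := by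
  simp_rw [← h, Finset.mul_sum]
  rw [Finset.sum_comm]
  simp_rw [← mul_assoc, ← Finset.sum_mul, sum_gInv_mul_g hz]
  simp

/-- Lowering an index. -/
theorem sum_g_of_eq_sum_gInv (hz : (gMat L z).det ≠ 0) {u w : Fin n → ℝ}
    (h : ∀ i, u i = ∑ a, gInv L i a z * w a) (i : Fin n) : ∑ a, g L i a z * u a = w i := by
  simp_rw [h, Finset.mul_sum]
  rw [Finset.sum_comm]
  simp_rw [← mul_assoc, ← Finset.sum_mul, sum_g_mul_gInv hz]
  simp

/-- `∂g⁻¹ = - g⁻¹ (∂g) g⁻¹`. -/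
theorem dir_gInv (hL : ContDiffAt ℝ ∞ L z) (hz : (gMat L z).det ≠ 0) (v : E n × E n) :
    (Matrix.of fun i j => dir v (gInv L i j) z)
      = -((gMat L z)⁻¹ * (Matrix.of fun i j => dir v (g L i j) z) * (gMat L z)⁻¹) := by
  have h : (Matrix.of fun i j => dir v (gInv L i j) z) * gMat L z
      + (gMat L z)⁻¹ * (Matrix.of fun i j => dir v (g L i j) z) = 0 := by
    ext i j
    have h1 : (fun x => ∑ a, gInv L i a x * g L a j x)
        =ᶠ[nhds z] fun _ => if i = j then (1 : ℝ) else 0 := by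
      filter_upwards [det_eventually_ne hL hz] with x hx using sum_gInv_mul_g hx i j
    have h2 := dir_congr v h1
    rw [dir_const, dir_sum_mul v _ (fun a => differentiableAt_of_smooth (gInv_smooth hL hz i a))
      (fun a => differentiableAt_of_smooth (g_smooth hL a j)), Finset.sum_add_distrib] at h2
    rw [Matrix.add_apply, Matrix.mul_apply, Matrix.mul_apply]
    exact h2
  have hu : IsUnit (gMat L z).det := isUnit_iff_ne_zero.2 hz
  have h3 := congrArg (· * (gMat L z)⁻¹) h
  simp only [add_mul, zero_mul] at h3
  rw [Matrix.mul_nonsing_inv_cancel_right _ _ hu] at h3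
  exact eq_neg_of_add_eq_zero_left h3

/-- The trace `g^{ab} ∂_v g_{ab}`, i.e. the derivative of `log |det g|`. -/
noncomputable def logDetDeriv (L : E n × E n → ℝ) (v : E n × E n) : E n × E n → ℝ :=
  fun z => ∑ a, ∑ b, gInv L a b z * dir v (g L a b) z

theorem logDetDeriv_smooth (hL : ContDiffAt ℝ ∞ L z) (hz : (gMat L z).det ≠ 0)
    (v : E n × E n) : ContDiffAt ℝ ∞ (logDetDeriv L v) z :=
  ContDiffAt.sum fun a _ => ContDiffAt.sum fun b _ =>
    (gInv_smooth hL hz a b).mul (dir_contDiffAt v (g_smooth hL a b))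

/-- These are mixed second derivatives of `log |det g|`. Explicitly they equal `-tr (g⁻¹ ∂_v g g⁻¹
∂_w g) + g^{ab} ∂_v ∂_w g_{ab}`, which is symmetric in `v` and `w` by cyclicity of the trace and
equality of mixed partials. -/
theorem dir_logDetDeriv_comm (hL : ContDiffAt ℝ ∞ L z) (hz : (gMat L z).det ≠ 0)
    (v w : E n × E n) : dir v (logDetDeriv L w) z = dir w (logDetDeriv L v) z := by
  have key : ∀ v w : E n × E n, dir v (logDetDeriv L w) z
      = -Matrix.trace ((gMat L z)⁻¹ * (Matrix.of fun i j => dir v (g L i j) z) * (gMat L z)⁻¹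
          * (Matrix.of fun i j => dir w (g L i j) z))
        + ∑ a, ∑ b, gInv L a b z * dir v (dir w (g L a b)) z := by
    intro v w
    unfold logDetDeriv
    rw [dir_sum v _ fun a _ => differentiableAt_of_smooth (ContDiffAt.sum fun b _ =>
      (gInv_smooth hL hz a b).mul (dir_contDiffAt w (g_smooth hL a b)))]
    simp_rw [dir_sum_mul v _
      (fun b => differentiableAt_of_smooth (gInv_smooth hL hz _ b))
      (fun b => differentiableAt_of_smooth (dir_contDiffAt w (g_smooth hL _ b))),
      Finset.sum_add_distrib]
    congr 1
    rw [← Matrix.trace_neg, ← Matrix.neg_mul, ← dir_gInv hL hz]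
    simp only [Matrix.trace, Matrix.diag_apply, Matrix.mul_apply, Matrix.of_apply]
    refine Finset.sum_congr rfl fun a _ => Finset.sum_congr rfl fun b _ => ?_
    rw [dir_congr w (g_eventually_symm hL a b)]
  rw [key, key]
  congr 1
  · rw [Matrix.mul_assoc, Matrix.trace_mul_comm]
    simp only [Matrix.mul_assoc]
  · refine Finset.sum_congr rfl fun a _ => Finset.sum_congr rfl fun b _ => ?_
    rw [dir_comm _ _ (g_smooth hL a b)]

theorem metricSpray_smooth (hL : ContDiffAt ℝ ∞ L z) (hz : (gMat L z).det ≠ 0) (i : Fin n) :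
    ContDiffAt ℝ ∞ (metricSpray L i) z := by
  unfold metricSpray
  refine contDiffAt_const.mul ?_
  refine ContDiffAt.sum fun a _ => ContDiffAt.sum fun b _ => ContDiffAt.sum fun c _ => ?_
  exact (((gInv_smooth hL hz i a).mul ((contDiffAt_const.mul (dx_contDiffAt c (g_smooth hL a b))).sub
    (dx_contDiffAt a (g_smooth hL b c)))).mul (smooth_snd b z)).mul (smooth_snd c z)

theorem metricN_smooth (hL : ContDiffAt ℝ ∞ L z) (hz : (gMat L z).det ≠ 0) (i k : Fin n) :
    ContDiffAt ℝ ∞ (metricN L i k) z :=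
  dy_contDiffAt i (metricSpray_smooth hL hz k)

end Tensor

/-! ### Locality -/

section Congr

variable {n : ℕ} {D : Set (E n × E n)} {L L' : E n × E n → ℝ}

theorem dir_eqOn {f h : E n × E n → ℝ} (hD : IsOpen D) (hfh : Set.EqOn f h D) (v : E n × E n) :
    Set.EqOn (dir v f) (dir v h) D := fun _ hz =>
  dir_congr v (hfh.eventuallyEq_of_mem (hD.mem_nhds hz))

theorem g_eqOn (hD : IsOpen D) (h : Set.EqOn L L' D) (i j : Fin n) :
    Set.EqOn (g L i j) (g L' i j) D := fun z hz => by
  have := dir_eqOn hD (dir_eqOn hD h (0, e i)) (0, e j) hz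
  simp only [g, dy_eq_dir, this]

theorem gMat_eqOn (hD : IsOpen D) (h : Set.EqOn L L' D) :
    Set.EqOn (gMat L) (gMat L') D := fun z hz => by
  ext i j; exact g_eqOn hD h i j hz

theorem gInv_eqOn (hD : IsOpen D) (h : Set.EqOn L L' D) (i j : Fin n) :
    Set.EqOn (gInv L i j) (gInv L' i j) D := fun z hz => by
  simp only [gInv, gMat_eqOn hD h hz]

theorem metricSpray_eqOn (hD : IsOpen D) (h : Set.EqOn L L' D) (i : Fin n) :
    Set.EqOn (metricSpray L i) (metricSpray L' i) D := fun z hz => by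
  have h1 : ∀ a b c, dx a (g L b c) z = dx a (g L' b c) z := fun a b c =>
    dir_eqOn hD (g_eqOn hD h b c) _ hz
  simp only [metricSpray, h1, gInv_eqOn hD h _ _ hz]

theorem metricN_eqOn (hD : IsOpen D) (h : Set.EqOn L L' D) (i k : Fin n) :
    Set.EqOn (metricN L i k) (metricN L' i k) D :=
  dir_eqOn hD (metricSpray_eqOn hD h k) _

end Congr

/-! ### Pseudo-Finsler metrics in natural coordinates -/

section CoordFinsler

variable {n : ℕ} {D : Set (E n × E n)} {L : E n × E n → ℝ}

theorem sum_rotate {ι : Type*} [Fintype ι] (F : ι → ι → ι → ℝ) :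
    ∑ c, ∑ i, ∑ j, F c i j = ∑ i, ∑ j, ∑ c, F c i j := by
  rw [Finset.sum_comm]
  exact Finset.sum_congr rfl fun i _ => Finset.sum_comm

theorem logDetDeriv_vertical {z : E n × E n} (i : Fin n) :
    logDetDeriv L (0, e i) z = 2 * meanCartan L i z := by
  simp only [logDetDeriv, meanCartan, cartan, Finset.mul_sum, dy_eq_dir]
  exact Finset.sum_congr rfl fun b _ => Finset.sum_congr rfl fun c _ => by ring

/-- A pseudo-Finsler metric in natural coordinates. -/
structure IsCoordFinsler (D : Set (E n × E n)) (L : E n × E n → ℝ) : Prop where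
  cone : IsOpenCone D
  smooth : ∀ z ∈ D, ContDiffAt ℝ ∞ L z
  homog : HomogOn D 2 L
  det_ne : ∀ z ∈ D, (gMat L z).det ≠ 0

namespace IsCoordFinsler

variable (hL : IsCoordFinsler D L) {z : E n × E n} (hz : z ∈ D)
include hL

theorem g_homog (i j : Fin n) : HomogOn D 0 (g L i j) := by
  have h1 : HomogOn D 1 (dy i L) := HomogOn.dy hL.cone hL.homog hL.smooth i
  have h2 : HomogOn D 0 (dy j (dy i L)) :=
    HomogOn.dy hL.cone h1 (fun z hz => dy_contDiffAt i (hL.smooth z hz)) j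
  intro z hz t ht
  simp only [g, h2 z hz t ht]; ring

theorem gInv_homog (i j : Fin n) : HomogOn D 0 (gInv L i j) := by
  intro z hz t ht
  have : gMat L (z.1, t • z.2) = gMat L z := by
    ext a b
    have := hL.g_homog a b z hz t ht
    rwa [pow_zero, one_mul] at this
  simp [gInv, this]

theorem metricSpray_homog (i : Fin n) : HomogOn D 2 (metricSpray L i) := by
  intro z hz t ht
  have h1 : ∀ a b c, dx a (g L b c) (z.1, t • z.2) = dx a (g L b c) z := fun a b c => by
    simpa using HomogOn.dx hL.cone (hL.g_homog b c) (fun z hz => g_smooth (hL.smooth z hz) b c) a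
      z hz t ht
  have h2 : ∀ a, gInv L i a (z.1, t • z.2) = gInv L i a z := fun a => by
    simpa using hL.gInv_homog i a z hz t ht
  simp only [metricSpray, h1, h2, PiLp.smul_apply, smul_eq_mul, Finset.mul_sum]
  refine Finset.sum_congr rfl fun a _ => Finset.sum_congr rfl fun b _ =>
    Finset.sum_congr rfl fun c _ => ?_
  ring

theorem metricN_homog (i k : Fin n) : HomogOn D 1 (metricN L i k) :=
  HomogOn.dy hL.cone (hL.metricSpray_homog k)
    (fun z hz => metricSpray_smooth (hL.smooth z hz) (hL.det_ne z hz) k) i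

include hz

/-- `y_i = ½ L_{·i}`. -/
theorem yLow_eq (i : Fin n) : yLow L i z = 1 / 2 * dy i L z := by
  have h1 : HomogOn D 1 (dy i L) := HomogOn.dy hL.cone hL.homog hL.smooth i
  have h2 := h1.euler (fun z hz => dy_contDiffAt i (hL.smooth z hz)) hz
  rw [Nat.cast_one, one_mul] at h2
  rw [← h2, Finset.mul_sum]
  refine Finset.sum_congr rfl fun a _ => ?_
  simp only [g]; ring

theorem dir_yLow (v : E n × E n) (i : Fin n) :
    dir v (yLow L i) z = 1 / 2 * dir v (dy i L) z := by
  rw [dir_congr v (h := fun z => 1 / 2 * dy i L z),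
    dir_const_mul _ _ (differentiableAt_of_smooth (dy_contDiffAt i (hL.smooth z hz)))]
  filter_upwards [hL.cone.isOpen.mem_nhds hz] with x hx using hL.yLow_eq hx i

theorem yLow_smooth (i : Fin n) : ContDiffAt ℝ ∞ (yLow L i) z :=
  ContDiffAt.sum fun a _ => (g_smooth (hL.smooth z hz) i a).mul (smooth_snd a z)

theorem dy_yLow (i j : Fin n) : dy j (yLow L i) z = g L i j z := by
  rw [dy_eq_dir, hL.dir_yLow hz]; rfl

theorem sum_yLow_mul : ∑ i, yLow L i z * z.2 i = L z := by
  have h2 := hL.homog.euler hL.smooth hz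
  simp only [hL.yLow_eq hz]
  calc ∑ i, 1 / 2 * dy i L z * z.2 i = 1 / 2 * ∑ i, z.2 i * dy i L z := by
        rw [Finset.mul_sum]; exact Finset.sum_congr rfl fun i _ => by ring
    _ = L z := by rw [h2]; push_cast; ring

theorem sum_gInv_mul_yLow (i : Fin n) : ∑ a, gInv L i a z * yLow L a z = z.2 i :=
  (eq_sum_gInv_of_sum_g (hL.det_ne z hz) (u := fun a => z.2 a) (w := fun a => yLow L a z)
    (fun _ => rfl) i).symm

theorem sum_dx_g_mul (i c : Fin n) :
    ∑ b, dx c (g L i b) z * z.2 b = 1 / 2 * dx c (dy i L) z := by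
  rw [dx_eq_dir (f := dy i L), ← hL.dir_yLow hz]
  unfold yLow
  rw [dir_sum_mul _ _ (fun a => differentiableAt_of_smooth (g_smooth (hL.smooth z hz) i a))
    (fun a => differentiableAt_of_smooth (smooth_snd a z))]
  refine Finset.sum_congr rfl fun b _ => ?_
  rw [dir_snd]
  simp [dx_eq_dir]

theorem sum_dx_g_mul_mul (a : Fin n) :
    ∑ b, ∑ c, dx a (g L b c) z * z.2 b * z.2 c = dx a L z := by
  have h := dir_congr ((e a : E n), (0 : E n)) (f := L) (h := fun z => ∑ i, yLow L i z * z.2 i)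
    (z := z) (by
      filter_upwards [hL.cone.isOpen.mem_nhds hz] with x hx using (hL.sum_yLow_mul hx).symm)
  rw [dir_sum_mul _ _ (fun a => differentiableAt_of_smooth (hL.yLow_smooth hz a))
    (fun a => differentiableAt_of_smooth (smooth_snd a z))] at h
  rw [dx_eq_dir a L, h]
  refine Finset.sum_congr rfl fun b _ => ?_
  rw [dir_snd, hL.dir_yLow hz, ← dx_eq_dir, ← hL.sum_dx_g_mul hz, Finset.sum_mul]
  simp only [PiLp.zero_apply, mul_zero, add_zero]
  exact Finset.sum_congr rfl fun c _ => by ring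

/-- The metric spray is determined by `4 g_{ia} G^a = y^c ∂_c L_{·i} - ∂_i L`. -/
theorem sum_g_mul_metricSpray (i : Fin n) :
    ∑ a, g L i a z * metricSpray L a z
      = 1 / 4 * (dir (z.2, 0) (dy i L) z - dx i L z) := by
  refine sum_g_of_eq_sum_gInv (hL.det_ne z hz) (u := fun a => metricSpray L a z)
    (w := fun i => 1 / 4 * (dir (z.2, 0) (dy i L) z - dx i L z)) (fun k => ?_) i
  simp only [metricSpray]
  rw [Finset.mul_sum]
  refine Finset.sum_congr rfl fun a _ => ?_
  have h1 : ∑ b, ∑ c, dx c (g L a b) z * z.2 b * z.2 c = 1 / 2 * dir (z.2, 0) (dy a L) z := by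
    rw [Finset.sum_comm, ← sum_mul_dx, Finset.mul_sum]
    refine Finset.sum_congr rfl fun c _ => ?_
    rw [← Finset.sum_mul, hL.sum_dx_g_mul hz]; ring
  rw [← hL.sum_dx_g_mul_mul hz a]
  have h2 : dir (z.2, 0) (dy a L) z = 2 * ∑ b, ∑ c, dx c (g L a b) z * z.2 b * z.2 c := by
    rw [h1]; ring
  rw [h2]
  simp only [Finset.mul_sum, ← Finset.sum_sub_distrib]
  exact Finset.sum_congr rfl fun b _ => Finset.sum_congr rfl fun c _ => by ring

/-- The trace of the metric nonlinear connection when the mean Cartan tensor vanishes. -/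
theorem sum_metricN_self (hC : ∀ i, meanCartan L i z = 0) :
    ∑ a, metricN L a a z = 1 / 2 * ∑ c, z.2 c * logDetDeriv L (e c, 0) z := by
  have hs := hL.smooth z hz
  have hG : ∀ a, DifferentiableAt ℝ (metricSpray L a) z := fun a =>
    differentiableAt_of_smooth (metricSpray_smooth hs (hL.det_ne z hz) a)
  have hC' : ∀ a, ∑ i, ∑ j, gInv L i j z * dy a (g L i j) z = 0 := by
    intro a
    have h := logDetDeriv_vertical (L := L) (z := z) a
    rw [hC, mul_zero] at h
    exact h
  -- The vertical derivative of `4 g_{ia} G^a = y^c ∂_c L_{·i} - ∂_i L`, split into a part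
  -- antisymmetric in `i, j` and a part symmetric in them. Contraction with `g^{ij}` will produce
  -- the trace of `N`.
  have key : ∀ i j, ∑ a, (dy j (g L i a) z * metricSpray L a z + g L i a z * metricN L j a z)
      = 1 / 4 * (dx j (dy i L) z - dx i (dy j L) z)
        + 1 / 2 * ∑ c, z.2 c * dx c (g L i j) z := by
    intro i j
    have h1 := dir_congr ((0 : E n), (e j : E n))
      (f := fun z => ∑ a, g L i a z * metricSpray L a z)
      (h := fun z => 1 / 4 * ((∑ c, z.2 c * dx c (dy i L) z) - dx i L z)) (z := z) (by
        filter_upwards [hL.cone.isOpen.mem_nhds hz] with x hx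
        rw [hL.sum_g_mul_metricSpray hx, sum_mul_dx])
    have hd : ∀ c, DifferentiableAt ℝ (dx c (dy i L)) z := fun c =>
      differentiableAt_of_smooth (dx_contDiffAt c (dy_contDiffAt i hs))
    have hd' : DifferentiableAt ℝ (dx i L) z := differentiableAt_of_smooth (dx_contDiffAt i hs)
    have hd'' : DifferentiableAt ℝ (fun z => ∑ c, z.2 c * dx c (dy i L) z) z :=
      differentiableAt_of_smooth (ContDiffAt.sum fun c _ =>
        (smooth_snd c z).mul (dx_contDiffAt c (dy_contDiffAt i hs)))
    rw [dir_sum_mul _ _ (fun a => differentiableAt_of_smooth (g_smooth hs i a)) hG,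
      dir_const_mul _ _ (hd''.fun_sub hd'), dir_sub _ hd'' hd',
      dir_sum_mul _ _ (fun a => differentiableAt_of_smooth (smooth_snd a z)) hd] at h1
    refine h1.trans ?_
    have h2 : dir (0, e j) (dx i L) z = dx i (dy j L) z := by
      rw [dx_eq_dir, dir_comm _ _ hs]; rfl
    have h3 : ∀ c, dir (0, e j) (dx c (dy i L)) z = 2 * dx c (g L i j) z := by
      intro c
      rw [dx_eq_dir, dx_eq_dir, dir_g hs, dir_comm _ _ (dy_contDiffAt i hs), dy_eq_dir j]; ring
    rw [h2, Finset.sum_add_distrib]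
    simp only [h3, dir_snd, e_apply, ite_mul, one_mul, zero_mul, Finset.sum_ite_eq',
      Finset.mem_univ, if_true]
    have h4 : ∑ c, z.2 c * (2 * dx c (g L i j) z) = 2 * ∑ c, z.2 c * dx c (g L i j) z := by
      rw [Finset.mul_sum]; exact Finset.sum_congr rfl fun c _ => by ring
    rw [h4]; ring
  have tr : ∑ i, ∑ j, gInv L i j z *
      ∑ a, (dy j (g L i a) z * metricSpray L a z + g L i a z * metricN L j a z)
      = ∑ i, ∑ j, gInv L i j z * (1 / 4 * (dx j (dy i L) z - dx i (dy j L) z)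
        + 1 / 2 * ∑ c, z.2 c * dx c (g L i j) z) := by simp only [key]
  have lhs : ∑ i, ∑ j, gInv L i j z *
      ∑ a, (dy j (g L i a) z * metricSpray L a z + g L i a z * metricN L j a z)
      = ∑ a, metricN L a a z := by
    -- By total symmetry this is `2 C_a G^a`.
    have e1 : ∑ i, ∑ j, gInv L i j z * ∑ a, dy j (g L i a) z * metricSpray L a z = 0 := by
      have : ∑ a, metricSpray L a z * ∑ i, ∑ j, gInv L i j z * dy a (g L i j) z = 0 := by
        simp [hC']
      rw [← this]
      simp only [Finset.mul_sum]
      rw [sum_rotate (fun a i j => metricSpray L a z * (gInv L i j z * dy a (g L i j) z))]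
      refine Finset.sum_congr rfl fun i _ => Finset.sum_congr rfl fun j _ =>
        Finset.sum_congr rfl fun a _ => ?_
      rw [dy_g_swap hs i j a]; ring
    have e2 : ∑ i, ∑ j, gInv L i j z * ∑ a, g L i a z * metricN L j a z
        = ∑ a, metricN L a a z := by
      rw [Finset.sum_comm]
      refine Finset.sum_congr rfl fun j _ => ?_
      have := eq_sum_gInv_of_sum_g (hL.det_ne z hz) (u := fun a => metricN L j a z)
        (w := fun i => ∑ a, g L i a z * metricN L j a z) (fun _ => rfl) j
      rw [this]
      exact Finset.sum_congr rfl fun i _ => by rw [gInv_symm hs]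
    simp only [Finset.sum_add_distrib, mul_add]
    rw [e1, e2, zero_add]
  have rhs : ∑ i, ∑ j, gInv L i j z * (1 / 4 * (dx j (dy i L) z - dx i (dy j L) z)
        + 1 / 2 * ∑ c, z.2 c * dx c (g L i j) z)
      = 1 / 2 * ∑ c, z.2 c * logDetDeriv L (e c, 0) z := by
    -- A symmetric tensor contracted with an antisymmetric one.
    have e1 : ∑ i, ∑ j, gInv L i j z * (1 / 4 * (dx j (dy i L) z - dx i (dy j L) z)) = 0 := by
      have h : ∑ i, ∑ j, gInv L i j z * (1 / 4 * (dx j (dy i L) z - dx i (dy j L) z))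
          = -∑ i, ∑ j, gInv L i j z * (1 / 4 * (dx j (dy i L) z - dx i (dy j L) z)) := by
        conv_lhs => rw [Finset.sum_comm]
        rw [← Finset.sum_neg_distrib]
        refine Finset.sum_congr rfl fun i _ => ?_
        rw [← Finset.sum_neg_distrib]
        refine Finset.sum_congr rfl fun j _ => ?_
        rw [gInv_symm hs j i]; ring
      linarith
    simp only [mul_add, Finset.sum_add_distrib]
    rw [e1, zero_add]
    simp only [logDetDeriv, Finset.mul_sum]
    rw [sum_rotate (fun c i j => 1 / 2 * (z.2 c * (gInv L i j z * dir (e c, 0) (g L i j) z)))]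
    refine Finset.sum_congr rfl fun i _ => Finset.sum_congr rfl fun j _ =>
      Finset.sum_congr rfl fun c _ => ?_
    rw [dx_eq_dir]; ring
  rw [← lhs, tr, rhs]

end IsCoordFinsler

end CoordFinsler

/-! ### Vanishing of the mean Landsberg tensor, and the affine equation for symmetric connections -/

section Solutions

variable {n : ℕ} {D : Set (E n × E n)} {L : E n × E n → ℝ}

namespace IsCoordFinsler

variable (hL : IsCoordFinsler D L)
include hL

theorem dy_metricN_comm {z : E n × E n} (hz : z ∈ D) (i j k : Fin n) :
    dy j (metricN L i k) z = dy i (metricN L j k) z :=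
  dir_comm _ _ (metricSpray_smooth (hL.smooth z hz) (hL.det_ne z hz) k)

/-- The mean Landsberg tensor vanishes if the mean Cartan tensor does. -/
theorem meanLandsberg_eq_zero (hC : ∀ z ∈ D, ∀ i, meanCartan L i z = 0) {z : E n × E n}
    (hz : z ∈ D) (i : Fin n) : meanLandsberg L i z = 0 := by
  have hs := hL.smooth z hz
  have hdet := hL.det_ne z hz
  -- Exchanging the derivatives gives `∂_c (2 C_i)`, and `C_i` vanishes on a neighbourhood.
  have hτ : ∀ c, dy i (logDetDeriv L (e c, 0)) z = 0 := by
    intro c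
    rw [dy_eq_dir, dir_logDetDeriv_comm hs hdet, dir_congr (h := fun _ => 0), dir_const]
    filter_upwards [hL.cone.isOpen.mem_nhds hz] with x hx
    rw [logDetDeriv_vertical, hC x hx, mul_zero]
  -- The derivative of `N_a^a = ½ y^c τ_c` along `y^i`; only the factor `y^c` contributes, by `hτ`.
  -- The symmetry of the metric connection then moves the derivative to the contracted index.
  have htr : ∑ a, dy a (metricN L i a) z = 1 / 2 * logDetDeriv L (e i, 0) z := by
    have h := dir_congr ((0 : E n), (e i : E n)) (f := fun z => ∑ a, metricN L a a z)
      (h := fun z => 1 / 2 * ∑ c, z.2 c * logDetDeriv L (e c, 0) z) (z := z) (by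
        filter_upwards [hL.cone.isOpen.mem_nhds hz] with x hx
          using hL.sum_metricN_self hx (hC x hx))
    rw [dir_sum _ _ (fun a _ => differentiableAt_of_smooth (metricN_smooth hs hdet a a)),
      dir_const_mul _ _ (differentiableAt_of_smooth (ContDiffAt.sum fun c _ =>
        (smooth_snd c z).mul (logDetDeriv_smooth hs hdet _))),
      dir_sum_mul _ _ (fun a => differentiableAt_of_smooth (smooth_snd a z))
        (fun c => differentiableAt_of_smooth (logDetDeriv_smooth hs hdet _))] at h
    simp only [← dy_eq_dir, hτ, mul_zero, add_zero] at h
    simp only [dy_eq_dir, dir_snd, e_apply, ite_mul, one_mul, zero_mul, Finset.sum_ite_eq',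
      Finset.mem_univ, if_true] at h
    rw [← h]
    exact Finset.sum_congr rfl fun a _ => hL.dy_metricN_comm hz i a a
  have h1 : ∑ a, ∑ b, gInv L a b z * ∑ c, metricN L i c z * dy c (g L a b) z = 0 := by
    have : ∑ c, metricN L i c z * logDetDeriv L (0, e c) z = 0 := by
      simp [logDetDeriv_vertical, hC z hz]
    rw [← this]
    simp only [logDetDeriv, Finset.mul_sum]
    rw [sum_rotate (fun c a b => metricN L i c z * (gInv L a b z * dir (0, e c) (g L a b) z))]
    exact Finset.sum_congr rfl fun a _ => Finset.sum_congr rfl fun b _ =>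
      Finset.sum_congr rfl fun c _ => by rw [dy_eq_dir]; ring
  have h2 : ∀ b, ∑ a, gInv L a b z * ∑ c, dy b (metricN L i c) z * g L a c z
      = dy b (metricN L i b) z := by
    intro b
    have := eq_sum_gInv_of_sum_g hdet (u := fun c => dy b (metricN L i c) z)
      (w := fun a => ∑ c, g L a c z * dy b (metricN L i c) z) (fun _ => rfl) b
    rw [this]
    refine Finset.sum_congr rfl fun a _ => ?_
    rw [gInv_symm hs]
    congr 1
    exact Finset.sum_congr rfl fun c _ => mul_comm _ _
  have h3 : ∀ a, ∑ b, gInv L a b z * ∑ c, dy a (metricN L i c) z * g L c b z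
      = dy a (metricN L i a) z := by
    intro a
    rw [← h2 a]
    refine Finset.sum_congr rfl fun b _ => ?_
    rw [gInv_symm hs]
    congr 1
    exact Finset.sum_congr rfl fun c _ => by rw [g_symm hs]
  -- The second term is `2 N_i^c C_c = 0` and each of the last two is `N^a_{i·a} = ½ τ_i`, so they
  -- cancel the first.
  have h4 : meanLandsberg L i z = 1 / 2 * (logDetDeriv L (e i, 0) z
      - ∑ a, ∑ b, gInv L a b z * ∑ c, metricN L i c z * dy c (g L a b) z
      - ∑ a, ∑ b, gInv L a b z * ∑ c, dy a (metricN L i c) z * g L c b z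
      - ∑ b, ∑ a, gInv L a b z * ∑ c, dy b (metricN L i c) z * g L a c z) := by
    rw [Finset.sum_comm (f := fun b a => gInv L a b z * ∑ c, dy b (metricN L i c) z * g L a c z)]
    simp only [meanLandsberg, landsberg, horiz, logDetDeriv, dx_eq_dir]
    simp only [← Finset.sum_sub_distrib, Finset.mul_sum (s := Finset.univ) (a := (1 / 2 : ℝ))]
    exact Finset.sum_congr rfl fun a _ => Finset.sum_congr rfl fun b _ => by ring
  rw [h4, h1]
  simp only [h2, h3, htr]
  ring

/-- If the mean Cartan tensor vanishes, then `J = 0` solves the affine equation. -/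
theorem affineLHS_zero (hC : ∀ z ∈ D, ∀ i, meanCartan L i z = 0) {z : E n × E n} (hz : z ∈ D)
    {J : Fin n → Fin n → E n × E n → ℝ} (hJ : ∀ z ∈ D, ∀ i k, J i k z = 0) (i j : Fin n) :
    affineLHS L J i j z = 0 := by
  have hd : ∀ a i k, dy a (J i k) z = 0 := by
    intro a i k
    rw [dy_eq_dir, dir_congr (h := fun _ => 0), dir_const]
    filter_upwards [hL.cone.isOpen.mem_nhds hz] with x hx using hJ x hx i k
  simp [affineLHS, affineCovector, hL.meanLandsberg_eq_zero hC hz, hC z hz, hd, hJ z hz]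

section Uniqueness

variable {J : Fin n → Fin n → E n × E n → ℝ}
  (hJs : ∀ z ∈ D, ∀ i k, ContDiffAt ℝ ∞ (J i k) z)
  (hJh : ∀ i k, HomogOn D 1 (J i k))
  (hJsym : ∀ z ∈ D, ∀ i j k, dy j (J i k) z = dy i (J j k) z)
include hJsym

/-- For symmetric `J` the affine equation reduces to the vanishing of a covector. -/
theorem affineCovector_eq_zero (hn : 2 ≤ n) {z : E n × E n} (hz : z ∈ D)
    (h : ∀ i j, affineLHS L J i j z = 0) (i : Fin n) : affineCovector L J i z = 0 := by
  -- The torsion term drops out and leaves `B_i y^j = (B_b y^b) δ_i^j` for the covector `B` in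
  -- braces. Its trace `B · y = n (B · y)` forces `B · y = 0`, and then a nonzero component of `y`
  -- gives `B = 0`.
  have h1 : ∀ i j, affineCovector L J i z * z.2 j
      = if i = j then ∑ b, affineCovector L J b z * z.2 b else 0 := by
    intro i j
    have := h i j
    simp only [affineLHS, hJsym z hz i _ j, sub_self, zero_mul, Finset.sum_const_zero, sub_zero,
      mul_sub, Finset.sum_sub_distrib, kron] at this
    have e1 : ∑ b, affineCovector L J b z * ((if i = b then (1 : ℝ) else 0) * z.2 j)
        = affineCovector L J i z * z.2 j := by
      simp
    rw [e1] at this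
    rw [sub_eq_zero.1 this]
    split_ifs <;> simp
  have h2 : ∑ b, affineCovector L J b z * z.2 b = 0 := by
    have : ∑ b, affineCovector L J b z * z.2 b
        = n * ∑ b, affineCovector L J b z * z.2 b := by
      conv_lhs =>
        enter [2, b]
        rw [h1, if_pos rfl]
      simp
    have hn' : (2 : ℝ) ≤ n := by exact_mod_cast hn
    nlinarith
  obtain ⟨j, hj⟩ : ∃ j, z.2 j ≠ 0 := by
    by_contra! hcon
    exact hL.cone.ne_zero z hz (by ext j; exact hcon j)
  have h3 := h1 i j
  rw [h2, ite_self] at h3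
  exact (mul_eq_zero.1 h3).resolve_right hj

include hJs hJh

omit hL in
/-- `S^k = J_i^k y^i` satisfies `S^k_{·j} = 2 J_j^k`. -/
theorem dy_sum_J {z : E n × E n} (hz : z ∈ D) (j k : Fin n) :
    dy j (fun z => ∑ i, J i k z * z.2 i) z = 2 * J j k z := by
  rw [dy_eq_dir, dir_sum_mul _ _ (fun i => differentiableAt_of_smooth (hJs z hz i k))
    (fun i => differentiableAt_of_smooth (smooth_snd i z)), Finset.sum_add_distrib]
  have h1 := (hJh j k).euler (fun z hz => hJs z hz j k) hz
  -- Symmetry turns `J^k_{i·j} y^i` into `J^k_{j·i} y^i`, to which Euler's theorem applies.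
  have h2 : ∑ i, dir (0, e j) (J i k) z * z.2 i = J j k z := by
    rw [Nat.cast_one, one_mul] at h1
    conv_rhs => rw [← h1]
    refine Finset.sum_congr rfl fun i _ => ?_
    rw [← dy_eq_dir, hJsym z hz i j k, mul_comm]
  rw [h2]
  simp only [dir_snd, e_apply, mul_ite, mul_one, mul_zero, Finset.sum_ite_eq',
    Finset.mem_univ, if_true]
  ring

end Uniqueness

end IsCoordFinsler

end Solutions

/-! ### The scalar equation for the trace of a symmetric solution -/

section Solutions

variable {n : ℕ} {D : Set (E n × E n)} {L : E n × E n → ℝ}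

/-- The vertical operator `g^{ab} f_{·a·b}`. -/
noncomputable def vertLap (L f : E n × E n → ℝ) : E n × E n → ℝ :=
  fun z => ∑ a, ∑ b, gInv L a b z * dy b (dy a f) z

namespace IsCoordFinsler

variable (hL : IsCoordFinsler D L) {J : Fin n → Fin n → E n × E n → ℝ}
  (hC : ∀ z ∈ D, ∀ i, meanCartan L i z = 0) (hL0 : ∀ z ∈ D, L z ≠ 0) (hn : 2 ≤ n)
  (hJs : ∀ z ∈ D, ∀ i k, ContDiffAt ℝ ∞ (J i k) z)
  (hJh : ∀ i k, HomogOn D 1 (J i k))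
  (hJsym : ∀ z ∈ D, ∀ i j k, dy j (J i k) z = dy i (J j k) z)
  (hJ : ∀ z ∈ D, ∀ i j, affineLHS L J i j z = 0)

include hL in
/-- If the mean Cartan tensor vanishes, then `g^{ab}_{·a} = 0`. -/
theorem sum_dy_gInv (hC : ∀ z ∈ D, ∀ i, meanCartan L i z = 0) {z : E n × E n} (hz : z ∈ D)
    (b : Fin n) : ∑ a, dy a (gInv L a b) z = 0 := by
  have hs := hL.smooth z hz
  have h1 : ∀ a, dy a (gInv L a b) z
      = -∑ d, ∑ c, gInv L a c z * dy a (g L c d) z * gInv L d b z := by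
    intro a
    have := congrFun (congrFun (dir_gInv hs (hL.det_ne z hz) (0, e a)) a) b
    simp only [Matrix.of_apply, Matrix.neg_apply, Matrix.mul_apply, Finset.sum_mul] at this
    exact this
  simp only [h1, Finset.sum_neg_distrib, neg_eq_zero]
  rw [Finset.sum_comm]
  refine Finset.sum_eq_zero fun d _ => ?_
  -- By total symmetry this is `2 C_d`.
  have h2 : ∑ a, ∑ c, gInv L a c z * dy a (g L c d) z = 0 := by
    have h3 := logDetDeriv_vertical (L := L) (z := z) d
    rw [hC z hz, mul_zero] at h3
    rw [← h3]
    refine Finset.sum_congr rfl fun a _ => Finset.sum_congr rfl fun c _ => ?_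
    rw [dy_g_swap hs c d a, dy_eq_dir, dir_congr _ (g_eventually_symm hs c a)]
  rw [← zero_mul (gInv L d b z), ← h2]
  simp only [Finset.sum_mul]

include hJs in
theorem trace_smooth {z : E n × E n} (hz : z ∈ D) :
    ContDiffAt ℝ ∞ (fun z => ∑ a, J a a z) z :=
  ContDiffAt.sum fun a _ => hJs z hz a a

include hJh in
theorem trace_homog : HomogOn D 1 (fun z => ∑ a, J a a z) := by
  intro z hz t ht
  simp only [hJh _ _ z hz t ht, Finset.mul_sum]

include hL hC hL0 hn hJsym hJ hJs in
-- The covector in braces vanishes; its Landsberg and Cartan terms are zero, and by symmetry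
-- `J^a_{b·a}` and `J^a_{a·b}` are both the vertical derivative of the trace.
theorem sum_yLow_mul_J {z : E n × E n} (hz : z ∈ D) (b : Fin n) :
    ((n : ℝ) + 2) * ∑ a, yLow L a z * J b a z
      = 2 * L z * dy b (fun z => ∑ a, J a a z) z := by
  have h := hL.affineCovector_eq_zero hJsym hn hz (hJ z hz) b
  simp only [affineCovector, hL.meanLandsberg_eq_zero hC hz, hC z hz, hJsym z hz b _ _,
    zero_mul, Finset.sum_const_zero, mul_zero, sub_zero, zero_add] at h
  have h1 : dy b (fun z => ∑ a, J a a z) z = ∑ a, dy b (J a a) z :=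
    dir_sum _ _ fun a _ => differentiableAt_of_smooth (hJs z hz a a)
  have h2 : ∑ a, yLow L a z / L z * J b a z = (∑ a, yLow L a z * J b a z) / L z := by
    rw [Finset.sum_div]; exact Finset.sum_congr rfl fun a _ => by ring
  rw [h2, Finset.sum_add_distrib, ← h1] at h
  have := hL0 z hz
  field_simp at h
  linarith

include hL hC hL0 hn hJs hJh hJsym hJ

/-- Contract `sum_yLow_mul_J` with `y^b` and apply Euler's theorem to the trace, which is
`1`-homogeneous. -/
theorem sum_yLow_mul_sum_J {z : E n × E n} (hz : z ∈ D) :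
    ((n : ℝ) + 2) * ∑ a, yLow L a z * ∑ i, J i a z * z.2 i
      = 2 * L z * ∑ a, J a a z := by
  have h1 := (trace_homog hJh).euler (fun z hz => trace_smooth hJs hz) hz
  rw [Nat.cast_one, one_mul] at h1
  conv_rhs => rw [← h1]
  simp only [Finset.mul_sum]
  rw [Finset.sum_comm]
  refine Finset.sum_congr rfl fun i _ => ?_
  have h2 := hL.sum_yLow_mul_J hC hL0 hn hJs hJsym hJ hz i
  calc _ = z.2 i * (((n : ℝ) + 2) * ∑ a, yLow L a z * J i a z) := by
        simp only [Finset.mul_sum]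
        exact Finset.sum_congr rfl fun a _ => by ring
    _ = _ := by rw [h2]; ring

/-- The vector `S^a = J_i^a y^i` in terms of the trace `f = J_a^a`:
`(n+2) S^a = 4 f y^a - 2 L g^{ab} f_{·b}`. -/
theorem sum_J_eq {z : E n × E n} (hz : z ∈ D) (a : Fin n) :
    ((n : ℝ) + 2) * ∑ i, J i a z * z.2 i
      = 4 * ((∑ c, J c c z) * z.2 a)
        - 2 * (L z * ∑ b, gInv L a b z * dy b (fun z => ∑ c, J c c z) z) := by
  have hs := hL.smooth z hz
  have hfd := differentiableAt_of_smooth (trace_smooth hJs hz)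
  have hSd : ∀ k, DifferentiableAt ℝ (fun z => ∑ i, J i k z * z.2 i) z := fun k =>
    differentiableAt_of_smooth (ContDiffAt.sum fun i _ => (hJs z hz i k).mul (smooth_snd i z))
  -- The derivative of `(n+2) y_a S^a = 2 L f` along `y^b`, where `y_{a·b} = g_{ab}` and `S^a_{·b} =
  -- 2 J_b^a`. The resulting `y_a J_b^a` is eliminated by `sum_yLow_mul_J`.
  have low : ∀ b, ∑ a, g L b a z * (((n : ℝ) + 2) * ∑ i, J i a z * z.2 i)
      = 4 * (∑ c, J c c z) * yLow L b z
        - 2 * L z * dy b (fun z => ∑ c, J c c z) z := by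
    intro b
    have h := dir_congr ((0 : E n), (e b : E n))
      (f := fun z => ((n : ℝ) + 2) * ∑ a, yLow L a z * ∑ i, J i a z * z.2 i)
      (h := fun z => 2 * (L z * ∑ a, J a a z)) (z := z) (by
        filter_upwards [hL.cone.isOpen.mem_nhds hz] with x hx
        rw [hL.sum_yLow_mul_sum_J hC hL0 hn hJs hJh hJsym hJ hx, mul_assoc])
    rw [dir_const_mul _ _ (DifferentiableAt.fun_sum fun a _ =>
        (differentiableAt_of_smooth (hL.yLow_smooth hz a)).fun_mul (hSd a)),
      dir_sum_mul _ _ (fun a => differentiableAt_of_smooth (hL.yLow_smooth hz a)) hSd,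
      dir_const_mul _ _ ((differentiableAt_of_smooth hs).fun_mul hfd),
      dir_mul _ (differentiableAt_of_smooth hs) hfd] at h
    simp only [← dy_eq_dir, hL.dy_yLow hz, dy_sum_J hJs hJh hJsym hz] at h
    rw [Finset.sum_add_distrib] at h
    have h1 := hL.sum_yLow_mul_J hC hL0 hn hJs hJsym hJ hz b
    have h2 : ∑ a, yLow L a z * (2 * J b a z) = 2 * ∑ a, yLow L a z * J b a z := by
      rw [Finset.mul_sum]; exact Finset.sum_congr rfl fun a _ => by ring
    have h3 : ∑ a, g L b a z * (((n : ℝ) + 2) * ∑ i, J i a z * z.2 i)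
        = ((n : ℝ) + 2) * ∑ a, g L a b z * ∑ i, J i a z * z.2 i := by
      rw [Finset.mul_sum]
      exact Finset.sum_congr rfl fun a _ => by rw [g_symm hs b a]; ring
    have h4 := hL.yLow_eq hz b
    rw [h2] at h
    rw [h3]
    linear_combination h - 2 * h1 - 4 * (∑ c, J c c z) * h4
  rw [eq_sum_gInv_of_sum_g (hL.det_ne z hz)
    (u := fun a => ((n : ℝ) + 2) * ∑ i, J i a z * z.2 i) low a, ← hL.sum_gInv_mul_yLow hz a]
  simp only [Finset.mul_sum, ← Finset.sum_sub_distrib, mul_sub]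
  refine Finset.sum_congr rfl fun b _ => ?_
  rw [← Finset.mul_sum]
  ring

/-- The trace `f = J_a^a` of a symmetric solution satisfies `L g^{ab} f_{·a·b} = (n-2) f`. -/
theorem mul_vertLap_trace {z : E n × E n} (hz : z ∈ D) :
    L z * vertLap L (fun z => ∑ c, J c c z) z = ((n : ℝ) - 2) * ∑ c, J c c z := by
  have hs := hL.smooth z hz
  have hdet := hL.det_ne z hz
  have hfs := trace_smooth hJs hz
  have hfd := differentiableAt_of_smooth hfs
  set f : E n × E n → ℝ := fun z => ∑ c, J c c z with hf
  have hSd : ∀ k, DifferentiableAt ℝ (fun z => ∑ i, J i k z * z.2 i) z := fun k =>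
    differentiableAt_of_smooth (ContDiffAt.sum fun i _ => (hJs z hz i k).mul (smooth_snd i z))
  have hgd : ∀ a b, DifferentiableAt ℝ (gInv L a b) z := fun a b =>
    differentiableAt_of_smooth (gInv_smooth hs hdet a b)
  have hfb : ∀ b, DifferentiableAt ℝ (dy b f) z := fun b =>
    differentiableAt_of_smooth (dy_contDiffAt b hfs)
  have hsum : ∀ a, DifferentiableAt ℝ (fun z => ∑ b, gInv L a b z * dy b f z) z := fun a =>
    DifferentiableAt.fun_sum fun b _ => (hgd a b).fun_mul (hfb b)
  have hLd := differentiableAt_of_smooth hs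
  -- The derivative of `sum_J_eq` along `y^a`, with `S^a_{·a} = 2 J_a^a` for each fixed `a`. Summed
  -- over `a`, it becomes `2 (n+2) f = 4 (n+1) f - 4 f - 2 L g^{ab} f_{·a·b}`.
  have h : ∀ a, ((n : ℝ) + 2) * (2 * J a a z)
      = 4 * (dy a f z * z.2 a + f z)
        - 2 * (dy a L z * ∑ b, gInv L a b z * dy b f z
          + L z * ∑ b, (dy a (gInv L a b) z * dy b f z + gInv L a b z * dy a (dy b f) z)) := by
    intro a
    have h := dir_congr ((0 : E n), (e a : E n))
      (f := fun z => ((n : ℝ) + 2) * ∑ i, J i a z * z.2 i)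
      (h := fun z => 4 * (f z * z.2 a) - 2 * (L z * ∑ b, gInv L a b z * dy b f z)) (z := z) (by
        filter_upwards [hL.cone.isOpen.mem_nhds hz] with x hx
          using hL.sum_J_eq hC hL0 hn hJs hJh hJsym hJ hx a)
    have hsa := differentiableAt_of_smooth (smooth_snd a z)
    rw [dir_const_mul _ _ (hSd a),
      dir_sub _ ((hfd.fun_mul hsa).const_mul 4) ((hLd.fun_mul (hsum a)).const_mul 2),
      dir_const_mul _ _ (hfd.fun_mul hsa), dir_const_mul _ _ (hLd.fun_mul (hsum a)),
      dir_mul _ hfd hsa, dir_mul _ hLd (hsum a), dir_sum_mul _ _ (hgd a) hfb,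
      dir_snd] at h
    simp only [← dy_eq_dir, dy_sum_J hJs hJh hJsym hz] at h
    rw [h]
    simp [e_apply]
  have hsumm : ∑ a, ((n : ℝ) + 2) * (2 * J a a z)
      = ∑ a, (4 * (dy a f z * z.2 a + f z)
        - 2 * (dy a L z * ∑ b, gInv L a b z * dy b f z
          + L z * ∑ b, (dy a (gInv L a b) z * dy b f z + gInv L a b z * dy a (dy b f) z))) :=
    Finset.sum_congr rfl fun a _ => h a
  have e1 : ∑ a, ((n : ℝ) + 2) * (2 * J a a z) = 2 * ((n : ℝ) + 2) * f z := by
    rw [hf, Finset.mul_sum]; exact Finset.sum_congr rfl fun a _ => by ring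
  have e2 : ∑ a, dy a f z * z.2 a = f z := by
    have h1 := (trace_homog hJh).euler (fun z hz => trace_smooth hJs hz) hz
    rw [Nat.cast_one, one_mul] at h1
    rw [hf]
    simp only
    conv_rhs => rw [← h1]
    exact Finset.sum_congr rfl fun a _ => mul_comm _ _
  have e3 : ∑ a, dy a L z * ∑ b, gInv L a b z * dy b f z = 2 * f z := by
    have : ∀ a, dy a L z = 2 * yLow L a z := fun a => by rw [hL.yLow_eq hz]; ring
    simp only [this, Finset.mul_sum]
    rw [Finset.sum_comm, ← e2, Finset.mul_sum]
    refine Finset.sum_congr rfl fun b _ => ?_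
    rw [← hL.sum_gInv_mul_yLow hz b]
    simp only [Finset.mul_sum]
    exact Finset.sum_congr rfl fun a _ => by rw [gInv_symm hs]; ring
  have e4 : ∑ a, ∑ b, dy a (gInv L a b) z * dy b f z = 0 := by
    rw [Finset.sum_comm]
    refine Finset.sum_eq_zero fun b _ => ?_
    rw [← Finset.sum_mul, hL.sum_dy_gInv hC hz, zero_mul]
  have e5 : ∑ a, ∑ b, gInv L a b z * dy a (dy b f) z = vertLap L f z := by
    refine Finset.sum_congr rfl fun a _ => Finset.sum_congr rfl fun b _ => ?_
    rw [dy_eq_dir, dy_eq_dir, dir_comm _ _ hfs]; rfl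
  rw [e1] at hsumm
  simp only [Finset.sum_sub_distrib, ← Finset.mul_sum, Finset.sum_add_distrib, e2, e3, e4, e5,
    Finset.sum_const, Finset.card_univ, Fintype.card_fin, nsmul_eq_mul] at hsumm
  linear_combination (1 / 2 : ℝ) * hsumm

/-- A symmetric solution with vanishing trace vanishes. -/
theorem J_eq_zero_of_trace (htr : ∀ z ∈ D, ∑ c, J c c z = 0) {z : E n × E n} (hz : z ∈ D)
    (i k : Fin n) : J i k z = 0 := by
  -- By `sum_J_eq` a zero trace gives `S = 0` on all of `D`; hence also `J = ½ S_·` vanishes.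
  have h1 : ∀ x ∈ D, ∑ i, J i k x * x.2 i = 0 := by
    intro x hx
    have h := hL.sum_J_eq hC hL0 hn hJs hJh hJsym hJ hx k
    have h2 : ∀ b, dy b (fun z => ∑ c, J c c z) x = 0 := by
      intro b
      rw [dy_eq_dir, dir_congr (h := fun _ => 0), dir_const]
      filter_upwards [hL.cone.isOpen.mem_nhds hx] with y hy using htr y hy
    simp only [h2, htr x hx, mul_zero, zero_mul, Finset.sum_const_zero, sub_zero] at h
    exact (mul_eq_zero.1 h).resolve_left (by positivity)
  have h3 := dy_sum_J hJs hJh hJsym hz i k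
  rw [dy_eq_dir, dir_congr (h := fun _ => 0), dir_const] at h3
  · linarith
  · filter_upwards [hL.cone.isOpen.mem_nhds hz] with x hx using h1 x hx

end IsCoordFinsler

end Solutions

/-! ### A maximum principle on Lorentzian cones -/

section MaximumPrinciple

variable {n : ℕ}

/-- The columns of `P` form an orthonormal basis and the diagonal matrix is its own inverse, so
inverting `Pᵀ G P = D` gives `G⁻¹ = P D Pᵀ`. -/
theorem IsLorentzian.exists_inv_eq {G : Matrix (Fin n) (Fin n) ℝ} (hG : IsLorentzian G) :
    ∃ (P : Matrix (Fin n) (Fin n) ℝ) (k : Fin n), IsUnit P.det ∧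
      P.transpose * G * P = Matrix.diagonal (fun i => if i = k then (1 : ℝ) else -1) ∧
      G⁻¹ = P * Matrix.diagonal (fun i => if i = k then (1 : ℝ) else -1) * P.transpose := by
  obtain ⟨P, hP, k, hk⟩ := hG
  refine ⟨P, k, hP, hk, ?_⟩
  set d : Fin n → ℝ := fun i => if i = k then (1 : ℝ) else -1 with hd
  have hdd : Matrix.diagonal d * Matrix.diagonal d = 1 := by
    rw [Matrix.diagonal_mul_diagonal, ← Matrix.diagonal_one]
    congr 1
    funext i
    simp only [hd]; split_ifs <;> norm_num
  have h1 : P.transpose * (G * P * Matrix.diagonal d) = 1 := by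
    rw [← hdd, ← hk]; simp only [Matrix.mul_assoc]
  have h2 := mul_eq_one_comm.1 h1
  apply Matrix.inv_eq_right_inv
  rw [← h2]; simp only [Matrix.mul_assoc]

/-- A positive semidefinite form that is degenerate along a timelike vector has nonpositive trace
with respect to a Lorentzian metric. -/
theorem IsLorentzian.trace_nonpos {G : Matrix (Fin n) (Fin n) ℝ} (hG : IsLorentzian G)
    {W : Matrix (Fin n) (Fin n) ℝ} (hW : W.PosSemidef) {y : Fin n → ℝ}
    (hy : 0 < y ⬝ᵥ (G.mulVec y)) (hWy : W.mulVec y = 0) : (G⁻¹ * W).trace ≤ 0 := by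
  obtain ⟨P, k, hP, hk, hinv⟩ := hG.exists_inv_eq
  set d : Fin n → ℝ := fun i => if i = k then (1 : ℝ) else -1 with hd
  obtain ⟨m, B, hB⟩ : ∃ (m : ℕ) (B : Matrix (Fin m) (Fin n) ℝ), W = B.transpose * B := by
    obtain ⟨m, v, hv⟩ := Matrix.posSemidef_iff_eq_sum_vecMulVec.1 hW
    refine ⟨m, Matrix.of v, ?_⟩
    ext i j
    simp [hv, Matrix.sum_apply, Matrix.vecMulVec_apply, Matrix.mul_apply]
  set u := P⁻¹.mulVec y with hu
  have hPu : P.mulVec u = y := by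
    rw [hu, Matrix.mulVec_mulVec, Matrix.mul_nonsing_inv _ hP, Matrix.one_mulVec]
  have hBy : B.mulVec y = 0 := by
    have h1 : (B.mulVec y) ⬝ᵥ (B.mulVec y) = 0 := by
      rw [Matrix.dotProduct_mulVec, ← Matrix.mulVec_transpose, Matrix.mulVec_mulVec, ← hB, hWy,
        zero_dotProduct]
    exact dotProduct_self_eq_zero.1 h1
  -- In the orthonormal basis the trace is `∑ r, C r k ^ 2` minus the spatial squares of the entries
  -- of `C`, and each row of `C` is orthogonal to the coordinate vector `u` of `y`.
  set C := B * P with hC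
  have hCu : ∀ r, ∑ i, C r i * u i = 0 := by
    intro r
    have : C.mulVec u = 0 := by rw [hC, ← Matrix.mulVec_mulVec, hPu, hBy]
    exact congrFun this r
  have hpos : 0 < ∑ i, d i * u i ^ 2 := by
    have h1 : y ⬝ᵥ (G.mulVec y) = u ⬝ᵥ ((Matrix.diagonal d).mulVec u) := by
      rw [← hk, ← Matrix.mulVec_mulVec, ← Matrix.mulVec_mulVec, hPu, Matrix.dotProduct_mulVec u,
        Matrix.vecMul_transpose, hPu]
    rw [h1] at hy
    refine hy.trans_eq ?_
    simp only [dotProduct, Matrix.mulVec_diagonal]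
    exact Finset.sum_congr rfl fun i _ => by ring
  have htr : (G⁻¹ * W).trace = ∑ i, d i * ∑ r, C r i ^ 2 := by
    have : (G⁻¹ * W).trace = (Matrix.diagonal d * (C.transpose * C)).trace := by
      rw [hinv, hB, hC, Matrix.transpose_mul, Matrix.mul_assoc, Matrix.mul_assoc,
        Matrix.trace_mul_comm]
      simp only [Matrix.mul_assoc]
    rw [this]
    simp only [Matrix.trace, Matrix.diag_apply, Matrix.diagonal_mul]
    refine Finset.sum_congr rfl fun i _ => ?_
    rw [Matrix.mul_apply]
    congr 1
    exact Finset.sum_congr rfl fun r _ => by rw [Matrix.transpose_apply]; ring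
  have split : ∀ c : Fin n → ℝ, ∑ i, d i * c i = c k - ∑ i ∈ Finset.univ.erase k, c i := by
    intro c
    rw [← Finset.add_sum_erase _ _ (Finset.mem_univ k), sub_eq_add_neg, ← Finset.sum_neg_distrib]
    congr 1
    · simp [hd]
    · refine Finset.sum_congr rfl fun i hi => ?_
      simp [hd, Finset.ne_of_mem_erase hi]
  rw [split] at hpos
  rw [htr, split]
  set s := ∑ i ∈ Finset.univ.erase k, u i ^ 2 with hs
  have hs0 : 0 ≤ s := Finset.sum_nonneg fun i _ => sq_nonneg _
  -- Orthogonality expresses `C r k * u k` through the spatial entries; Cauchy–Schwarz bounds it.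
  -- Since `y` is timelike, `s < u k ^ 2`, so the time entries are dominated by the spatial ones.
  have hrow : ∀ r, u k ^ 2 * C r k ^ 2 ≤ s * ∑ i ∈ Finset.univ.erase k, C r i ^ 2 := by
    intro r
    have h1 := hCu r
    rw [← Finset.add_sum_erase _ _ (Finset.mem_univ k)] at h1
    have h2 := Finset.sum_mul_sq_le_sq_mul_sq (Finset.univ.erase k) (fun i => C r i) u
    have h3 : u k ^ 2 * C r k ^ 2 = (∑ i ∈ Finset.univ.erase k, C r i * u i) ^ 2 := by
      have h4 : ∑ i ∈ Finset.univ.erase k, C r i * u i = -(C r k * u k) := by linarith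
      rw [h4]
      ring
    rw [h3, mul_comm s]
    exact h2
  have hsum : u k ^ 2 * ∑ r, C r k ^ 2 ≤ s * ∑ i ∈ Finset.univ.erase k, ∑ r, C r i ^ 2 := by
    rw [Finset.sum_comm, Finset.mul_sum, Finset.mul_sum]
    exact Finset.sum_le_sum fun r _ => hrow r
  set T := ∑ i ∈ Finset.univ.erase k, ∑ r, C r i ^ 2 with hT
  have hT0 : 0 ≤ T := Finset.sum_nonneg fun i _ => Finset.sum_nonneg fun r _ => sq_nonneg _
  have huk : 0 < u k ^ 2 := by linarith
  have : u k ^ 2 * ∑ r, C r k ^ 2 ≤ u k ^ 2 * T :=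
    hsum.trans (mul_le_mul_of_nonneg_right (by linarith) hT0)
  have := le_of_mul_le_mul_left this huk
  linarith

theorem hasDerivAt_line {f : E n × E n → ℝ} {z v : E n × E n} {t : ℝ}
    (hf : DifferentiableAt ℝ f (z + t • v)) :
    HasDerivAt (fun t : ℝ => f (z + t • v)) (dir v f (z + t • v)) t := by
  have hc : HasDerivAt (fun t : ℝ => z + t • v) v t := by
    simpa using ((hasDerivAt_id t).smul_const v).const_add z
  exact hf.hasFDerivAt.comp_hasDerivAt t hc

theorem eventually_line {p : E n × E n → Prop} {z : E n × E n} (h : ∀ᶠ x in nhds z, p x)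
    (v : E n × E n) : ∀ᶠ t : ℝ in nhds 0, p (z + t • v) := by
  have hc : Filter.Tendsto (fun t : ℝ => z + t • v) (nhds 0) (nhds z) := by
    have : ContinuousAt (fun t : ℝ => z + t • v) 0 := by fun_prop
    simpa [ContinuousAt] using this
  exact hc.eventually h

/-- Necessary conditions for a local minimum along a line. -/
theorem dir_of_isLocalMin_line {f : E n × E n → ℝ} {z : E n × E n} (hf : ContDiffAt ℝ ∞ f z)
    {v : E n × E n} (hmin : ∀ᶠ t : ℝ in nhds 0, f z ≤ f (z + t • v)) :
    dir v f z = 0 ∧ 0 ≤ dir v (dir v f) z := by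
  have hloc : IsLocalMin (fun t : ℝ => f (z + t • v)) 0 := by
    filter_upwards [hmin] with t ht; simpa using ht
  have hd0 : HasDerivAt (fun t : ℝ => f (z + t • v)) (dir v f z) 0 := by
    simpa using hasDerivAt_line (z := z) (v := v) (t := 0)
      (by simpa using differentiableAt_of_smooth hf)
  have hz0 : dir v f z = 0 := by rw [← hd0.deriv]; exact hloc.deriv_eq_zero
  have hev : ∀ᶠ x in nhds z, DifferentiableAt ℝ f x := by
    have := (hf.of_le (m := 1) (by simp)).eventually (by simp)
    filter_upwards [this] with x hx using hx.differentiableAt (by simp)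
  have hderiv : deriv (fun t : ℝ => f (z + t • v)) =ᶠ[nhds 0] fun t => dir v f (z + t • v) := by
    filter_upwards [eventually_line hev v] with t ht using (hasDerivAt_line ht).deriv
  have hd2 : deriv (deriv (fun t : ℝ => f (z + t • v))) 0 = dir v (dir v f) z := by
    rw [hderiv.deriv_eq]
    have := hasDerivAt_line (f := dir v f) (z := z) (v := v) (t := 0)
      (by simpa using differentiableAt_of_smooth (dir_contDiffAt v hf))
    simpa using this.deriv
  refine ⟨hz0, ?_⟩
  by_contra! hneg
  -- A negative second derivative would make the local minimum a local maximum too. The function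
  -- would then be locally constant, with second derivative zero.
  have hmax : IsLocalMax (fun t : ℝ => f (z + t • v)) 0 :=
    isLocalMax_of_deriv_deriv_neg (by rw [hd2]; exact hneg) hloc.deriv_eq_zero hd0.continuousAt
  have hconst : (fun t : ℝ => f (z + t • v)) =ᶠ[nhds 0] fun _ => f z := by
    filter_upwards [hmax, hloc] with t h1 h2
    simp only [zero_smul, add_zero] at h1 h2
    exact le_antisymm h1 h2
  have h0 : deriv (deriv (fun t : ℝ => f (z + t • v))) 0 = 0 := by
    rw [hconst.deriv.deriv_eq]; simp
  rw [← hd2, h0] at hneg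
  exact lt_irrefl _ hneg

/-- The vertical Hessian. -/
noncomputable def vertHess (f : E n × E n → ℝ) (z : E n × E n) : Matrix (Fin n) (Fin n) ℝ :=
  Matrix.of fun a b => dy b (dy a f) z

theorem dir_dir_eq_vertHess {f : E n × E n → ℝ} {z : E n × E n} (hf : ContDiffAt ℝ ∞ f z)
    (c : E n) : dir (0, c) (dir (0, c) f) z = (c : Fin n → ℝ) ⬝ᵥ (vertHess f z).mulVec c := by
  have h1 : ∀ a, dir (0, c) (dy a f) z = ∑ b, c b * vertHess f z a b := fun a =>
    (sum_mul_dy (dy a f) z c).symm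
  have h2 : dir (0, c) (dir (0, c) f) z = ∑ a, c a * dir (0, c) (dy a f) z := by
    rw [dir_congr (h := fun z => ∑ a, c a * dy a f z)
      _ (Filter.Eventually.of_forall fun x => (sum_mul_dy f x c).symm),
      dir_sum _ _ fun a _ => (differentiableAt_of_smooth (dy_contDiffAt a hf)).const_mul _]
    exact Finset.sum_congr rfl fun a _ =>
      dir_const_mul _ _ (differentiableAt_of_smooth (dy_contDiffAt a hf))
  rw [h2]
  simp only [h1, dotProduct, Matrix.mulVec]
  exact Finset.sum_congr rfl fun a _ => by
    congr 1; exact Finset.sum_congr rfl fun b _ => mul_comm _ _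

theorem vertHess_posSemidef {f : E n × E n → ℝ} {z : E n × E n} (hf : ContDiffAt ℝ ∞ f z)
    (h : ∀ c : E n, 0 ≤ dir (0, c) (dir (0, c) f) z) : (vertHess f z).PosSemidef := by
  refine .of_dotProduct_mulVec_nonneg ?_ fun x => ?_
  · ext a b
    simp only [vertHess, Matrix.conjTranspose_apply, Matrix.of_apply, star_trivial, dy_eq_dir]
    exact dir_comm _ _ hf
  · have := h (WithLp.toLp 2 x)
    rw [dir_dir_eq_vertHess hf] at this
    simpa using this

variable {D : Set (E n × E n)} {L f : E n × E n → ℝ}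

namespace IsCoordFinsler

variable (hL : IsCoordFinsler D L) (hpos : ∀ z ∈ D, 0 < L z)
  (hlor : ∀ z ∈ D, IsLorentzian (gMat L z))
  (hfs : ∀ z ∈ D, ContDiffAt ℝ ∞ f z) (hfh : HomogOn D 1 f)
  (hf : ∀ z ∈ D, L z * vertLap L f z = ((n : ℝ) - 2) * f z)
include hL hpos hlor hfs hfh hf

/-- A solution of `L g^{ab} f_{·a·b} = (n-2) f` cannot have an interior maximum of `f² / L` on a
fibre, unless it vanishes there. -/
theorem eq_zero_of_isMax {z : E n × E n} (hz : z ∈ D) {m : ℝ}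
    (hle : ∀ y, (z.1, y) ∈ D → f (z.1, y) ^ 2 ≤ m * L (z.1, y)) (heq : f z ^ 2 = m * L z) :
    f z = 0 := by
  by_contra hfz
  have hm : 0 < m := by
    have h1 : 0 < f z ^ 2 := by positivity
    rw [heq] at h1
    exact pos_of_mul_pos_left h1 (hpos z hz).le
  have hs := hL.smooth z hz
  have hdet := hL.det_ne z hz
  -- On the fibre `w ≥ 0`, with equality at `z`; using `w` instead of the quotient `f² / L` avoids
  -- differentiating a fraction.
  set w : E n × E n → ℝ := fun z => m * L z - f z * f z with hw
  have hws : ∀ z ∈ D, ContDiffAt ℝ ∞ w z := fun z hz =>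
    (contDiffAt_const.mul (hL.smooth z hz)).sub ((hfs z hz).mul (hfs z hz))
  have hwh : HomogOn D 2 w := by
    intro x hx t ht
    simp only [hw, hL.homog x hx t ht, hfh x hx t ht]; ring
  have hmin : ∀ c : E n, ∀ᶠ t : ℝ in nhds 0, w z ≤ w (z + t • ((0 : E n), c)) := by
    intro c
    filter_upwards [eventually_line (hL.cone.isOpen.mem_nhds hz) ((0 : E n), c)] with t ht
    have h1 : z + t • ((0 : E n), c) = (z.1, z.2 + t • c) := by ext <;> simp
    change z + t • ((0 : E n), c) ∈ D at ht
    rw [h1] at ht ⊢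
    have := hle _ ht
    simp only [hw]
    nlinarith
  have hcrit : ∀ a, dy a w z = 0 := fun a => (dir_of_isLocalMin_line (hws z hz) (hmin (e a))).1
  have hpsd : (vertHess w z).PosSemidef := vertHess_posSemidef (hws z hz) fun c =>
    (dir_of_isLocalMin_line (hws z hz) (hmin c)).2
  -- Euler's theorem for the `1`-homogeneous functions `w_{·a}`, which vanish at `z`.
  have hker : (vertHess w z).mulVec z.2 = 0 := by
    ext a
    have h1 : HomogOn D 1 (dy a w) := HomogOn.dy hL.cone hwh hws a
    have h2 := h1.euler (fun z hz => dy_contDiffAt a (hws z hz)) hz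
    rw [hcrit, mul_zero] at h2
    rw [Pi.zero_apply, ← h2]
    simp only [Matrix.mulVec, dotProduct, vertHess, Matrix.of_apply]
    exact Finset.sum_congr rfl fun b _ => mul_comm _ _
  have hy : 0 < (z.2 : Fin n → ℝ) ⬝ᵥ ((gMat L z).mulVec z.2) := by
    refine (hpos z hz).trans_eq ?_
    rw [← hL.sum_yLow_mul hz]
    exact Finset.sum_congr rfl fun i _ => mul_comm _ _
  have htr := (hlor z hz).trace_nonpos hpsd hy hker
  have hfd : ∀ x ∈ D, DifferentiableAt ℝ f x := fun x hx => differentiableAt_of_smooth (hfs x hx)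
  have hLd : ∀ x ∈ D, DifferentiableAt ℝ L x := fun x hx =>
    differentiableAt_of_smooth (hL.smooth x hx)
  have hdw : ∀ a, ∀ x ∈ D, dy a w x = m * dy a L x - 2 * (f x * dy a f x) := by
    intro a x hx
    rw [dy_eq_dir, dir_sub _ ((hLd x hx).const_mul m) ((hfd x hx).fun_mul (hfd x hx)),
      dir_const_mul _ _ (hLd x hx), dir_mul _ (hfd x hx) (hfd x hx)]
    simp only [dy_eq_dir]; ring
  have hddw : ∀ a b, dy b (dy a w) z
      = 2 * m * g L a b z - 2 * (dy a f z * dy b f z) - 2 * (f z * dy b (dy a f) z) := by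
    intro a b
    have h1 : DifferentiableAt ℝ (dy a L) z := differentiableAt_of_smooth (dy_contDiffAt a hs)
    have h2 : DifferentiableAt ℝ (dy a f) z :=
      differentiableAt_of_smooth (dy_contDiffAt a (hfs z hz))
    rw [dy_eq_dir, dir_congr (h := fun x => m * dy a L x - 2 * (f x * dy a f x)),
      dir_sub _ (h1.const_mul m) (((hfd z hz).fun_mul h2).const_mul 2),
      dir_const_mul _ _ h1, dir_const_mul _ _ ((hfd z hz).fun_mul h2), dir_mul _ (hfd z hz) h2]
    · simp only [g, dy_eq_dir]; ring
    · filter_upwards [hL.cone.isOpen.mem_nhds hz] with x hx using hdw a x hx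
  have hfa : ∀ a, f z * dy a f z = m * yLow L a z := by
    intro a
    have h1 := hdw a z hz
    rw [hcrit] at h1
    rw [hL.yLow_eq hz]
    linarith
  -- The critical point condition `f f_{·a} = m y_a` and `g^{ab} y_a y_b = L`; dividing by `f² = m
  -- L` gives `g^{ab} f_{·a} f_{·b} = m`.
  have hgrad : f z ^ 2 * ∑ a, ∑ b, gInv L a b z * (dy a f z * dy b f z) = m ^ 2 * L z := by
    have h1 : ∑ a, ∑ b, gInv L a b z * (yLow L a z * yLow L b z) = L z := by
      rw [← hL.sum_yLow_mul hz]
      refine Finset.sum_congr rfl fun a _ => ?_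
      rw [← hL.sum_gInv_mul_yLow hz a, Finset.mul_sum]
      exact Finset.sum_congr rfl fun b _ => by ring
    rw [← h1]
    simp only [Finset.mul_sum]
    refine Finset.sum_congr rfl fun a _ => Finset.sum_congr rfl fun b _ => ?_
    linear_combination gInv L a b z * (f z * dy b f z * hfa a + m * yLow L a z * hfa b)
  have hgg : ∑ a, ∑ b, gInv L a b z * g L a b z = n := by
    have : ∀ a, ∑ b, gInv L a b z * g L a b z = 1 := by
      intro a
      have := sum_gInv_mul_g hdet a a
      rw [if_pos rfl] at this
      rw [← this]
      exact Finset.sum_congr rfl fun b _ => by rw [g_symm hs a b]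
    simp [this]
  have htr' : ((gMat L z)⁻¹ * vertHess w z).trace = 2 * m * n
      - 2 * ∑ a, ∑ b, gInv L a b z * (dy a f z * dy b f z) - 2 * (f z * vertLap L f z) := by
    rw [← hgg]
    have h1 : ((gMat L z)⁻¹ * vertHess w z).trace = ∑ a, ∑ b, gInv L a b z * dy b (dy a w) z := by
      simp only [Matrix.trace, Matrix.diag_apply, Matrix.mul_apply]
      refine Finset.sum_congr rfl fun a _ => Finset.sum_congr rfl fun b _ => ?_
      simp only [vertHess, Matrix.of_apply]
      rw [dy_eq_dir, dy_eq_dir, dir_comm _ _ (hws z hz)]; rfl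
    rw [h1]
    simp only [vertLap, Finset.mul_sum, ← Finset.sum_sub_distrib]
    exact Finset.sum_congr rfl fun a _ => Finset.sum_congr rfl fun b _ => by rw [hddw]; ring
  have hLz := hpos z hz
  have hgrad' : ∑ a, ∑ b, gInv L a b z * (dy a f z * dy b f z) = m := by
    rw [heq] at hgrad
    have : m * L z ≠ 0 := (mul_pos hm hLz).ne'
    apply mul_left_cancel₀ this
    rw [hgrad]; ring
  have hlap : f z * vertLap L f z = ((n : ℝ) - 2) * m := by
    apply mul_left_cancel₀ hLz.ne'
    have := hf z hz
    linear_combination f z * this + ((n : ℝ) - 2) * heq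
  -- The trace is now `2 m n - 2 m - 2 (n-2) m = 2 m`, which is positive.
  rw [htr', hgrad', hlap] at htr
  linarith

/-- Maximum principle: if `f² / L` tends to `0` at the boundary of the cones, then `f = 0`. -/
theorem eq_zero_of_boundary
    (hbd : ∀ z ∉ D, z.2 ≠ 0 → (∃ y, (z.1, y) ∈ D) →
      Filter.Tendsto (fun x => f x ^ 2 / L x) (nhdsWithin z D) (nhds 0))
    {z : E n × E n} (hz : z ∈ D) : f z = 0 := by
  classical
  -- Extension by zero makes `Q` defined on the whole sphere, where compactness applies. At points
  -- off `D` it is continuous, since it tends to `0` along `D` by `hbd` and is `0` along the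
  -- complement.
  set Q : E n × E n → ℝ := D.indicator fun x => f x ^ 2 / L x with hQ
  have hQD : ∀ x ∈ D, Q x = f x ^ 2 / L x := fun x hx => Set.indicator_of_mem hx _
  have hQc : ∀ y : E n, y ≠ 0 → ContinuousAt Q (z.1, y) := by
    intro y hy
    by_cases hD : (z.1, y) ∈ D
    · have : ContinuousAt (fun x => f x ^ 2 / L x) (z.1, y) :=
        ((hfs _ hD).continuousAt.pow 2).div (hL.smooth _ hD).continuousAt (hpos _ hD).ne'
      refine this.congr ?_
      filter_upwards [hL.cone.isOpen.mem_nhds hD] with x hx using (hQD x hx).symm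
    · have h0 : Q (z.1, y) = 0 := Set.indicator_of_notMem hD _
      rw [ContinuousAt, h0, ← nhdsWithin_univ, ← Set.union_compl_self D, nhdsWithin_union]
      refine Filter.Tendsto.sup ?_ ?_
      · refine (hbd (z.1, y) hD hy ⟨z.2, hz⟩).congr' ?_
        filter_upwards [self_mem_nhdsWithin] with x hx using (hQD x hx).symm
      · refine tendsto_const_nhds.congr' ?_
        filter_upwards [self_mem_nhdsWithin] with x hx
        exact (Set.indicator_of_notMem hx _).symm
  have hQh : ∀ y, (z.1, y) ∈ D → ∀ t : ℝ, 0 < t → Q (z.1, t • y) = Q (z.1, y) := by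
    intro y hy t ht
    rw [hQD _ (hL.cone.smul_mem _ hy t ht), hQD _ hy]
    have h1 := hfh _ hy t ht
    have h2 := hL.homog _ hy t ht
    simp only at h1 h2
    rw [h1, h2, pow_one, mul_pow, mul_div_mul_left _ _ (pow_ne_zero 2 ht.ne')]
  have hnorm : ∀ y, (z.1, y) ∈ D → ‖y‖⁻¹ • y ∈ Metric.sphere (0 : E n) 1 := by
    intro y hy
    have : ‖y‖ ≠ 0 := norm_ne_zero_iff.2 (hL.cone.ne_zero _ hy)
    rw [mem_sphere_zero_iff_norm, norm_smul, norm_inv, norm_norm, inv_mul_cancel₀ this]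
  have hcont : ContinuousOn (fun y => Q (z.1, y)) (Metric.sphere (0 : E n) 1) := by
    intro y hy
    have hy0 : y ≠ 0 := by
      rintro rfl; simp at hy
    have h2 : ContinuousAt (fun y : E n => (z.1, y)) y := by fun_prop
    exact (ContinuousAt.comp (f := fun y : E n => (z.1, y)) (hQc y hy0) h2).continuousWithinAt
  obtain ⟨y₀, hy₀, hmax⟩ :=
    (isCompact_sphere (0 : E n) 1).exists_isMaxOn ⟨_, hnorm z.2 hz⟩ hcont
  have hle : ∀ y, (z.1, y) ∈ D → Q (z.1, y) ≤ Q (z.1, y₀) := by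
    intro y hy
    rw [← hQh y hy (‖y‖⁻¹) (inv_pos.2 (norm_pos_iff.2 (hL.cone.ne_zero _ hy)))]
    exact hmax (hnorm y hy)
  -- The maximum is zero either by the interior argument or because it is attained off `D`.
  have hQ0 : Q (z.1, y₀) = 0 := by
    by_cases hD : (z.1, y₀) ∈ D
    · have h1 := hL.eq_zero_of_isMax hpos hlor hfs hfh hf hD (m := Q (z.1, y₀))
        (fun y hy => by
          have := hle y hy
          rw [hQD _ hy, div_le_iff₀ (hpos _ hy)] at this
          exact this)
        (by rw [hQD _ hD, div_mul_cancel₀ _ (hpos _ hD).ne'])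
      rw [hQD _ hD, h1]; simp
    · exact Set.indicator_of_notMem hD _
  have h1 := hle z.2 hz
  rw [hQ0, hQD _ hz, div_le_iff₀ (hpos _ hz), zero_mul] at h1
  exact pow_eq_zero_iff (two_ne_zero) |>.1 (le_antisymm h1 (sq_nonneg _))

end IsCoordFinsler

end MaximumPrinciple

/-! ### Uniqueness of proper symmetric solutions in natural coordinates -/

section Boundary

variable {n : ℕ} {D : Set (E n × E n)} {L f : E n × E n → ℝ}

theorem vertLap_eqOn {L' f' : E n × E n → ℝ} (hD : IsOpen D) (hL : Set.EqOn L L' D)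
    (hf : Set.EqOn f f' D) : Set.EqOn (vertLap L f) (vertLap L' f') D := fun z hz => by
  have h : ∀ a b, dy b (dy a f) z = dy b (dy a f') z := fun a b =>
    dir_eqOn hD (dir_eqOn hD hf _) _ hz
  simp only [vertLap, gInv_eqOn hD hL _ _ hz, h]

theorem vertLap_smooth {z : E n × E n} (hL : ContDiffAt ℝ ∞ L z) (hz : (gMat L z).det ≠ 0)
    (hf : ContDiffAt ℝ ∞ f z) : ContDiffAt ℝ ∞ (vertLap L f) z :=
  ContDiffAt.sum fun a _ => ContDiffAt.sum fun b _ =>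
    (gInv_smooth hL hz a b).mul (dy_contDiffAt b (dy_contDiffAt a hf))

/-- Near a point where `L` and `f` extend smoothly with `L = 0` and `g` nondegenerate, a solution
of `L g^{ab} f_{·a·b} = (n-2) f` satisfies `f² / L → 0`. -/
theorem tendsto_sq_div_of_extension (hn : 3 ≤ n) (hD : IsOpen D) (hL0 : ∀ z ∈ D, L z ≠ 0)
    (hf : ∀ z ∈ D, L z * vertLap L f z = ((n : ℝ) - 2) * f z) {z : E n × E n}
    {W : Set (E n × E n)} (hW : IsOpen W) (hzW : z ∈ W) {L' f' : E n × E n → ℝ}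
    (hL's : ContDiffAt ℝ ∞ L' z) (hf's : ContDiffAt ℝ ∞ f' z) (hdet : (gMat L' z).det ≠ 0)
    (hL'z : L' z = 0) (hLL' : Set.EqOn L L' (W ∩ D)) (hff' : Set.EqOn f f' (W ∩ D)) :
    Filter.Tendsto (fun x => f x ^ 2 / L x) (nhdsWithin z D) (nhds 0) := by
  have hc : ContinuousAt (fun x => L' x * vertLap L' f' x ^ 2 / ((n : ℝ) - 2) ^ 2) z :=
    (hL's.continuousAt.mul ((vertLap_smooth hL's hdet hf's).continuousAt.pow 2)).div_const _
  have h0 := hc.tendsto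
  rw [hL'z, zero_mul, zero_div] at h0
  refine (h0.mono_left nhdsWithin_le_nhds).congr' ?_
  filter_upwards [self_mem_nhdsWithin, nhdsWithin_le_nhds (hW.mem_nhds hzW)] with x hxD hxW
  have hx : x ∈ W ∩ D := ⟨hxW, hxD⟩
  rw [← hLL' hx, ← vertLap_eqOn (hW.inter hD) hLL' hff' hx]
  have hn' : (n : ℝ) - 2 ≠ 0 := by
    have : (3 : ℝ) ≤ n := by exact_mod_cast hn
    linarith
  have h1 := hf x hxD
  have h2 := hL0 x hxD
  rw [div_eq_div_iff (pow_ne_zero 2 hn') h2]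
  -- The claim is `(L Δf)² = ((n-2) f)²` with `Δf = g^{ab} f_{·a·b}`: a difference of squares with
  -- `h1` as one factor.
  linear_combination (L x * vertLap L f x + ((n : ℝ) - 2) * f x) * h1

/-- A symmetric solution of the affine equation that extends smoothly to the boundary vanishes. -/
theorem IsCoordFinsler.J_eq_zero (hn : 3 ≤ n) (hL : IsCoordFinsler D L)
    {N : Fin n → Fin n → E n × E n → ℝ}
    (hpos : ∀ z ∈ D, 0 < L z) (hlor : ∀ z ∈ D, IsLorentzian (gMat L z))
    (hC : ∀ z ∈ D, ∀ i, meanCartan L i z = 0)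
    (hNs : ∀ z ∈ D, ∀ i k, ContDiffAt ℝ ∞ (N i k) z) (hNh : ∀ i k, HomogOn D 1 (N i k))
    (hNsym : ∀ z ∈ D, ∀ i j k, dy j (N i k) z = dy i (N j k) z)
    (hN : ∀ z ∈ D, ∀ i j, affineLHS L (fun i k z => N i k z - metricN L i k z) i j z = 0)
    (hbd : ∀ z ∉ D, z ∈ closure D → z.2 ≠ 0 → (∃ y, (z.1, y) ∈ D) →
      ∃ (W : Set (E n × E n)) (L' : E n × E n → ℝ) (N' : Fin n → E n × E n → ℝ),
        IsOpen W ∧ z ∈ W ∧ ContDiffAt ℝ ∞ L' z ∧ (∀ a, ContDiffAt ℝ ∞ (N' a) z) ∧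
        (gMat L' z).det ≠ 0 ∧ L' z = 0 ∧ Set.EqOn L L' (W ∩ D) ∧
        ∀ a, Set.EqOn (N a a) (N' a) (W ∩ D))
    {z : E n × E n} (hz : z ∈ D) (i k : Fin n) : N i k z = metricN L i k z := by
  have hms : ∀ z ∈ D, ∀ i k, ContDiffAt ℝ ∞ (metricN L i k) z := fun z hz i k =>
    metricN_smooth (hL.smooth z hz) (hL.det_ne z hz) i k
  set J : Fin n → Fin n → E n × E n → ℝ := fun i k z => N i k z - metricN L i k z with hJdef
  have hJs : ∀ z ∈ D, ∀ i k, ContDiffAt ℝ ∞ (J i k) z := fun z hz i k =>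
    (hNs z hz i k).sub (hms z hz i k)
  have hJh : ∀ i k, HomogOn D 1 (J i k) := by
    intro i k x hx t ht
    simp only [hJdef, hNh i k x hx t ht, hL.metricN_homog i k x hx t ht]; ring
  have hJsym : ∀ z ∈ D, ∀ i j k, dy j (J i k) z = dy i (J j k) z := by
    intro x hx i j k
    have h1 : ∀ i j, dy j (J i k) x = dy j (N i k) x - dy j (metricN L i k) x := fun i j =>
      dir_sub _ (differentiableAt_of_smooth (hNs x hx i k))
        (differentiableAt_of_smooth (hms x hx i k))
    rw [h1, h1, hNsym x hx, hL.dy_metricN_comm hx]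
  have hL0 : ∀ z ∈ D, L z ≠ 0 := fun x hx => (hpos x hx).ne'
  have hn2 : 2 ≤ n := by omega
  have hpde : ∀ x ∈ D, L x * vertLap L (fun z => ∑ c, J c c z) x
      = ((n : ℝ) - 2) * ∑ c, J c c x := fun x hx =>
    hL.mul_vertLap_trace hC hL0 hn2 hJs hJh hJsym hN hx
  have htr : ∀ x ∈ D, ∑ c, J c c x = 0 := by
    intro x hx
    refine hL.eq_zero_of_boundary (f := fun z => ∑ c, J c c z) hpos hlor
      (fun z hz => IsCoordFinsler.trace_smooth hJs hz) (IsCoordFinsler.trace_homog hJh) hpde ?_ hx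
    intro p hp hp0 hpf
    by_cases hcl : p ∈ closure D
    · obtain ⟨W, L', N', hW, hpW, hL's, hN's, hdet, hL'0, hLL', hNN'⟩ := hbd p hp hcl hp0 hpf
      refine tendsto_sq_div_of_extension hn hL.cone.isOpen hL0 hpde hW hpW hL's
        (f' := fun z => ∑ c, (N' c z - metricN L' c c z)) ?_ hdet hL'0 hLL' ?_
      · exact ContDiffAt.sum fun c _ => (hN's c).sub (metricN_smooth hL's hdet c c)
      · intro q hq
        refine Finset.sum_congr rfl fun c _ => ?_
        simp only [hJdef]
        rw [hNN' c hq, metricN_eqOn (hW.inter hL.cone.isOpen) hLL' c c hq]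
    -- Away from the closure of `D` the limit along `D` is vacuous.
    · rw [mem_closure_iff_nhdsWithin_neBot, Filter.not_neBot] at hcl
      rw [hcl]
      exact Filter.tendsto_bot
  exact sub_eq_zero.1 (hL.J_eq_zero_of_trace hC hL0 hn2 hJs hJh hJsym hN htr hz i k)

end Boundary

/-! ### The change of coordinates of the metric spray -/

section Transition

variable {n : ℕ} {D : Set (E n × E n)} {L : E n × E n → ℝ}

/-- The coefficients of the metric spray as a vector. -/
noncomputable def sprayVec (L : E n × E n → ℝ) (z : E n × E n) : E n :=
  WithLp.toLp 2 fun k => metricSpray L k z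

/-- The direction `(y, -2G)` is the value of the spray field `y^a ∂_a - 2 G^a ∂/∂y^a`, whose
integral curves solve `x'' + 2 G = 0`. -/
theorem dir_dy_spray (z : E n × E n) (G : E n) (i : Fin n) : dir (z.2, -(2 : ℝ) • G) (dy i L) z
      = dir (z.2, 0) (dy i L) z - 4 * ∑ a, g L i a z * G a := by
  have h1 : ((z.2, -(2 : ℝ) • G) : E n × E n) = (z.2, 0) + (-(2 : ℝ)) • ((0 : E n), G) := by
    ext <;> simp
  have h2 : dir ((0 : E n), G) (dy i L) z = 2 * ∑ a, g L i a z * G a := by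
    rw [← sum_mul_dy, Finset.mul_sum]
    exact Finset.sum_congr rfl fun a _ => by simp only [g]; ring
  have h3 : dir ((z.2, 0) + (-(2 : ℝ)) • ((0 : E n), G)) (dy i L) z
      = dir (z.2, 0) (dy i L) z + -(2 : ℝ) * dir ((0 : E n), G) (dy i L) z := by
    unfold dir; rw [map_add, map_smul, smul_eq_mul]
  rw [h1, h3, h2]; ring

/-- The Euler–Lagrange equations of `L`. They are tested on an arbitrary `w`, because a change of
coordinates does not preserve the standard basis. -/
theorem IsCoordFinsler.dir_sprayVec (hL : IsCoordFinsler D L) {z : E n × E n} (hz : z ∈ D)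
    (w : E n) : dir (z.2, -(2 : ℝ) • sprayVec L z) (dir (0, w) L) z = dir (w, 0) L z := by
  have hs := hL.smooth z hz
  have h1 : ∀ i, dir (z.2, -(2 : ℝ) • sprayVec L z) (dy i L) z = dx i L z := by
    intro i
    rw [dir_dy_spray]
    have := hL.sum_g_mul_metricSpray hz i
    simp only [sprayVec]
    rw [this]; ring
  rw [dir_congr (h := fun z => ∑ i, w i * dy i L z)
      _ (Filter.Eventually.of_forall fun x => (sum_mul_dy L x w).symm),
    dir_sum _ _ fun a _ => (differentiableAt_of_smooth (dy_contDiffAt a hs)).const_mul _,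
    ← sum_mul_dx]
  refine Finset.sum_congr rfl fun i _ => ?_
  rw [dir_const_mul _ _ (differentiableAt_of_smooth (dy_contDiffAt i hs)), h1]

/-- As `g` is nondegenerate, the Euler–Lagrange equations have only one solution. The transformation
law of the spray is thus a matter of checking them. -/
theorem IsCoordFinsler.eq_sprayVec (hL : IsCoordFinsler D L) {z : E n × E n} (hz : z ∈ D)
    {G : E n} (hG : ∀ i, dir (z.2, -(2 : ℝ) • G) (dy i L) z = dx i L z) :
    G = sprayVec L z := by
  ext k
  have hdet := hL.det_ne z hz
  have h1 : ∀ i, ∑ a, g L i a z * G a = ∑ a, g L i a z * metricSpray L a z := by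
    intro i
    have := hG i
    rw [dir_dy_spray] at this
    rw [hL.sum_g_mul_metricSpray hz]; linarith
  rw [eq_sum_gInv_of_sum_g hdet (u := fun a => G a) h1 k]
  exact (eq_sum_gInv_of_sum_g hdet (u := fun a => metricSpray L a z) (fun _ => rfl) k).symm

/-- The change of natural coordinates induced by a change of coordinates `T`. -/
noncomputable def liftMap (T : E n → E n) (z : E n × E n) : E n × E n :=
  (T z.1, fderiv ℝ T z.1 z.2)

section Lift

variable {T : E n → E n} {z : E n × E n}

theorem fderiv_smooth (hT : ContDiffAt ℝ ∞ T z.1) : ContDiffAt ℝ ∞ (fderiv ℝ T) z.1 :=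
  hT.fderiv_right (by simp)

theorem fderiv_liftMap (hT : ContDiffAt ℝ ∞ T z.1) (v : E n × E n) :
    fderiv ℝ (liftMap T) z v = (fderiv ℝ T z.1 v.1,
      fderiv ℝ (fderiv ℝ T) z.1 v.1 z.2 + fderiv ℝ T z.1 v.2) ∧
    DifferentiableAt ℝ (liftMap T) z := by
  have h1 : HasFDerivAt (fun z : E n × E n => T z.1)
      ((fderiv ℝ T z.1).comp (ContinuousLinearMap.fst ℝ (E n) (E n))) z :=
    (hT.differentiableAt (by simp)).hasFDerivAt.comp z hasFDerivAt_fst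
  have h2 : HasFDerivAt (fun z : E n × E n => fderiv ℝ T z.1)
      ((fderiv ℝ (fderiv ℝ T) z.1).comp (ContinuousLinearMap.fst ℝ (E n) (E n))) z :=
    ((fderiv_smooth hT).differentiableAt (by simp)).hasFDerivAt.comp z hasFDerivAt_fst
  have h3 := h2.clm_apply (hasFDerivAt_snd (𝕜 := ℝ) (p := z))
  have h4 : HasFDerivAt (liftMap T) _ z := h1.prodMk h3
  refine ⟨?_, h4.differentiableAt⟩
  rw [h4.fderiv]
  ext <;> simp [add_comm]

/-- The transformation of the metric spray: `T' Ḡ = G ∘ Φ + ½ T''(ȳ, ȳ)`. -/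
theorem sprayVec_liftMap {D' : Set (E n × E n)} {L' : E n × E n → ℝ}
    (hL : IsCoordFinsler D L) (hL' : IsCoordFinsler D' L') (hT : ContDiffAt ℝ ∞ T z.1)
    (hsurj : Function.Surjective (fderiv ℝ T z.1)) (hz : z ∈ D') (hTz : liftMap T z ∈ D)
    (hLL' : L' =ᶠ[nhds z] L ∘ liftMap T) :
    sprayVec L (liftMap T z) = fderiv ℝ T z.1 (sprayVec L' z)
      - (1 / 2 : ℝ) • fderiv ℝ (fderiv ℝ T) z.1 z.2 z.2 := by
  symm
  refine hL.eq_sprayVec hTz fun i => ?_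
  -- The equation for `L` in the direction `e i` is the one for `L'` in a direction `w` with `T' w =
  -- e i`.
  obtain ⟨w, hw⟩ := hsurj (e i)
  have key := hL'.dir_sprayVec hz w
  have hsL := hL.smooth _ hTz
  have hdL : DifferentiableAt ℝ L (liftMap T z) := differentiableAt_of_smooth hsL
  have hΦ := fun v => (fderiv_liftMap hT v).1
  have hΦd := (fderiv_liftMap hT 0).2
  have hd2 : DifferentiableAt ℝ (fderiv ℝ L) (liftMap T z) :=
    (hsL.fderiv_right (m := ∞) (by simp)).differentiableAt (by simp)
  have first : ∀ v, dir v L' z = fderiv ℝ L (liftMap T z) (fderiv ℝ (liftMap T) z v) := by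
    intro v
    unfold dir
    rw [hLL'.fderiv_eq, fderiv_comp z hdL hΦd]; rfl
  have near : dir (0, w) L' =ᶠ[nhds z]
      fun x => fderiv ℝ L (liftMap T x) (0, fderiv ℝ T x.1 w) := by
    have e1 : ∀ᶠ x in nhds z, ContDiffAt ℝ 2 T x.1 := by
      have := (hT.of_le (m := 2) (WithTop.coe_le_coe.2 (le_top : (2 : ℕ∞) ≤ ⊤))).eventually
        (by simp)
      exact continuous_fst.continuousAt.eventually this
    have e2 : ∀ᶠ x in nhds z, DifferentiableAt ℝ L (liftMap T x) := by
      have := (hsL.of_le (m := 1) (by simp)).eventually (by simp)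
      filter_upwards [hΦd.continuousAt.eventually this] with x hx
        using hx.differentiableAt (by simp)
    filter_upwards [hLL'.eventuallyEq_nhds, e1, e2] with x hx h1 h2
    have k1 : HasFDerivAt (fun z : E n × E n => T z.1)
        ((fderiv ℝ T x.1).comp (ContinuousLinearMap.fst ℝ (E n) (E n))) x :=
      (h1.differentiableAt (by simp)).hasFDerivAt.comp x hasFDerivAt_fst
    have k2 : HasFDerivAt (fun z : E n × E n => fderiv ℝ T z.1)
        ((fderiv ℝ (fderiv ℝ T) x.1).comp (ContinuousLinearMap.fst ℝ (E n) (E n))) x :=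
      ((h1.fderiv_right (m := 1) (by norm_num)).differentiableAt (by simp)).hasFDerivAt.comp x
        hasFDerivAt_fst
    have k4 : HasFDerivAt (liftMap T) _ x :=
      k1.prodMk (k2.clm_apply (hasFDerivAt_snd (𝕜 := ℝ) (p := x)))
    unfold dir
    rw [hx.fderiv_eq, fderiv_comp x h2 k4.differentiableAt, k4.fderiv]
    simp
  have hTw : HasFDerivAt (fun x : E n × E n => ((0 : E n), fderiv ℝ T x.1 w))
      ((0 : E n × E n →L[ℝ] E n).prod (((fderiv ℝ (fderiv ℝ T) z.1).comp
        (ContinuousLinearMap.fst ℝ (E n) (E n))).flip w)) z := by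
    have k2 : HasFDerivAt (fun z : E n × E n => fderiv ℝ T z.1)
        ((fderiv ℝ (fderiv ℝ T) z.1).comp (ContinuousLinearMap.fst ℝ (E n) (E n))) z :=
      ((fderiv_smooth hT).differentiableAt (by simp)).hasFDerivAt.comp z hasFDerivAt_fst
    have := k2.clm_apply (hasFDerivAt_const w z)
    simp only [ContinuousLinearMap.comp_zero, zero_add] at this
    exact (hasFDerivAt_const (0 : E n) z).prodMk this
  have second : ∀ v, dir v (dir (0, w) L') z
      = fderiv ℝ (fderiv ℝ L) (liftMap T z) (fderiv ℝ (liftMap T) z v) (0, fderiv ℝ T z.1 w)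
        + fderiv ℝ L (liftMap T z) (0, fderiv ℝ (fderiv ℝ T) z.1 v.1 w) := by
    intro v
    rw [dir_congr v near]
    unfold dir
    have k := (hd2.hasFDerivAt.comp z hΦd.hasFDerivAt).clm_apply hTw
    have k' : HasFDerivAt (fun x => fderiv ℝ L (liftMap T x) (0, fderiv ℝ T x.1 w)) _ z := k
    rw [k'.fderiv]
    simp [add_comm]
  rw [second, first, hΦ, hΦ, hw] at key
  have hsymm : fderiv ℝ (fderiv ℝ T) z.1 z.2 w = fderiv ℝ (fderiv ℝ T) z.1 w z.2 := by
    have h2 : minSmoothness ℝ 2 ≤ (∞ : ℕ∞ω) := by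
      rw [minSmoothness_of_isRCLikeNormedField]
      exact WithTop.coe_le_coe.2 (le_top : (2 : ℕ∞) ≤ ⊤)
    exact (hT.isSymmSndFDerivAt h2).eq _ _
  have hsplit : ((e i : E n), fderiv ℝ (fderiv ℝ T) z.1 w z.2)
      = ((e i : E n), (0 : E n)) + ((0 : E n), fderiv ℝ (fderiv ℝ T) z.1 w z.2) := by
    ext <;> simp
  simp only [hsymm, map_zero, add_zero] at key
  rw [hsplit, map_add] at key
  -- Both sides contain the derivative of `L` along `(0, T''(w, y))`; without it, `key` is the
  -- Euler–Lagrange equation at `liftMap T z`.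
  have key' := add_right_cancel key
  rw [dy_eq_dir, dir_dir_eq _ _ hsL, dx_eq_dir]
  unfold dir
  rw [← key']
  congr 2
  simp only [liftMap, Prod.mk.injEq, true_and]
  rw [smul_sub, map_smul, smul_smul]
  module

end Lift

end Transition

/-! ### The change of coordinates of the metric nonlinear connection -/

section Transition

variable {n : ℕ} {D D' : Set (E n × E n)} {L L' : E n × E n → ℝ} {T : E n → E n} {z : E n × E n}

theorem dir_fst_eq_zero {φ : E n → ℝ} (hφ : DifferentiableAt ℝ φ z.1) (w : E n) :
    dir (0, w) (fun z => φ z.1) z = 0 := by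
  have h : HasFDerivAt (fun z : E n × E n => φ z.1)
      ((fderiv ℝ φ z.1).comp (ContinuousLinearMap.fst ℝ (E n) (E n))) z :=
    hφ.hasFDerivAt.comp z hasFDerivAt_fst
  unfold dir
  rw [h.fderiv]; simp

theorem apply_eq_sum (A : E n →L[ℝ] E n) (v : E n) (k : Fin n) :
    A v k = ∑ a, A (e a) k * v a := by
  conv_lhs => rw [← sum_smul_e v, map_sum]
  simp [mul_comm]

theorem differentiableAt_coord {F : E n → E n} {x : E n} (hF : DifferentiableAt ℝ F x)
    (k : Fin n) : DifferentiableAt ℝ (fun x => F x k) x :=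
  (EuclideanSpace.proj k : E n →L[ℝ] ℝ).differentiableAt.comp x hF

theorem differentiableAt_fst_comp {φ : E n → ℝ} (hφ : DifferentiableAt ℝ φ z.1) :
    DifferentiableAt ℝ (fun z : E n × E n => φ z.1) z :=
  hφ.comp z differentiableAt_fst

/-- The transformation of the metric nonlinear connection. -/
theorem fderiv_metricN_liftMap (hL : IsCoordFinsler D L) (hL' : IsCoordFinsler D' L')
    (hT : ∀ᶠ x in nhds z, ContDiffAt ℝ ∞ T x.1)
    (hsurj : ∀ᶠ x in nhds z, Function.Surjective (fderiv ℝ T x.1))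
    (hz : z ∈ D') (hTD : ∀ᶠ x in nhds z, liftMap T x ∈ D)
    (hLL' : L' =ᶠ[nhds z] L ∘ liftMap T) (i k : Fin n) :
    ∑ a, fderiv ℝ T z.1 (e a) k * metricN L' i a z
      = fderiv ℝ (fderiv ℝ T) z.1 (e i) z.2 k
        + ∑ a, fderiv ℝ T z.1 (e i) a * metricN L a k (liftMap T z) := by
  have hTz := hT.self_of_nhds
  have hTDz := hTD.self_of_nhds
  set B : Fin n → Fin n → E n → ℝ := fun b c x => fderiv ℝ (fderiv ℝ T) x (e b) (e c) k with hB
  have hBd : ∀ b c, DifferentiableAt ℝ (B b c) z.1 := by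
    intro b c
    have h1 : ContDiffAt ℝ ∞ (fderiv ℝ (fderiv ℝ T)) z.1 :=
      (fderiv_smooth hTz).fderiv_right (by simp)
    exact differentiableAt_coord (((h1.clm_apply contDiffAt_const).clm_apply
      contDiffAt_const).differentiableAt (by simp)) k
  have hAd : ∀ a, DifferentiableAt ℝ (fun x => fderiv ℝ T x (e a) k) z.1 := fun a =>
    differentiableAt_coord (((fderiv_smooth hTz).clm_apply
      contDiffAt_const).differentiableAt (by simp)) k
  have hBexp : ∀ x : E n × E n, ∀ u v : E n, fderiv ℝ (fderiv ℝ T) x.1 u v k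
      = ∑ b, u b * ∑ c, B b c x.1 * v c := by
    intro x u v
    conv_lhs => rw [← sum_smul_e u, map_sum]
    simp only [map_smul, _root_.sum_apply, _root_.smul_apply,
      WithLp.ofLp_sum, Finset.sum_apply, PiLp.smul_apply, smul_eq_mul]
    exact Finset.sum_congr rfl fun b _ => by rw [apply_eq_sum]
  -- The transformation law of the spray in components. The derivatives of `T` depend on `x` alone,
  -- so the `y^i`-derivative sees only the spray and the quadratic form `½ T''(y, y)`, which becomes
  -- `T''(e_i, y)`.
  have hev : (fun x => metricSpray L k (liftMap T x)) =ᶠ[nhds z] fun x =>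
      (∑ a, fderiv ℝ T x.1 (e a) k * metricSpray L' a x)
        - 1 / 2 * ∑ b, x.2 b * ∑ c, B b c x.1 * x.2 c := by
    filter_upwards [hT, hsurj, hTD, hLL'.eventuallyEq_nhds, hL'.cone.isOpen.mem_nhds hz]
      with x h1 h2 h3 h4 h5
    have := congrArg (fun v : E n => v k) (sprayVec_liftMap hL hL' h1 h2 h5 h3 h4)
    simp only [PiLp.sub_apply, PiLp.smul_apply, smul_eq_mul] at this
    rw [apply_eq_sum, hBexp] at this
    exact this
  have hG' : ∀ a, DifferentiableAt ℝ (metricSpray L' a) z := fun a =>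
    differentiableAt_of_smooth (metricSpray_smooth (hL'.smooth z hz) (hL'.det_ne z hz) a)
  have hBz : ∀ b c, DifferentiableAt ℝ (fun x : E n × E n => B b c x.1) z := fun b c =>
    differentiableAt_fst_comp (hBd b c)
  have hsn : ∀ c, DifferentiableAt ℝ (fun x : E n × E n => x.2 c) z := fun c =>
    differentiableAt_of_smooth (smooth_snd c z)
  have hBs : ∀ b, DifferentiableAt ℝ (fun x : E n × E n => ∑ c, B b c x.1 * x.2 c) z := fun b =>
    DifferentiableAt.fun_sum fun c _ => (hBz b c).fun_mul (hsn c)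
  have hAz : ∀ a, DifferentiableAt ℝ (fun x : E n × E n => fderiv ℝ T x.1 (e a) k) z := fun a =>
    differentiableAt_fst_comp (hAd a)
  have h := dir_congr ((0 : E n), (e i : E n)) hev
  rw [dir_sub _ (DifferentiableAt.fun_sum fun a _ => (hAz a).fun_mul (hG' a))
      ((DifferentiableAt.fun_sum fun b _ => (hsn b).fun_mul (hBs b)).const_mul _),
    dir_sum_mul _ _ hAz hG',
    dir_const_mul _ _ (DifferentiableAt.fun_sum fun b _ => (hsn b).fun_mul (hBs b)),
    dir_sum_mul _ _ hsn hBs] at h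
  simp only [dir_sum_mul _ _ (hBz _) hsn, dir_fst_eq_zero (hAd _), dir_fst_eq_zero (hBd _ _),
    dir_snd, zero_mul, zero_add, Finset.sum_add_distrib] at h
  have lhs : dir (0, e i) (fun x => metricSpray L k (liftMap T x)) z
      = ∑ a, fderiv ℝ T z.1 (e i) a * metricN L a k (liftMap T z) := by
    have hd : DifferentiableAt ℝ (metricSpray L k) (liftMap T z) :=
      differentiableAt_of_smooth
        (metricSpray_smooth (hL.smooth _ hTDz) (hL.det_ne _ hTDz) k)
    unfold metricN
    rw [sum_mul_dy]
    unfold dir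
    change fderiv ℝ (metricSpray L k ∘ liftMap T) z _ = _
    rw [fderiv_comp z hd (fderiv_liftMap hTz 0).2, ContinuousLinearMap.comp_apply,
      (fderiv_liftMap hTz _).1]
    simp
  have q1 : ∑ b, (e i : E n) b * ∑ c, B b c z.1 * z.2 c
      = fderiv ℝ (fderiv ℝ T) z.1 (e i) z.2 k := (hBexp z _ _).symm
  have q2 : ∑ b, z.2 b * ∑ c, B b c z.1 * (e i : E n) c
      = fderiv ℝ (fderiv ℝ T) z.1 (e i) z.2 k := by
    have h2 : minSmoothness ℝ 2 ≤ (∞ : ℕ∞ω) := by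
      rw [minSmoothness_of_isRCLikeNormedField]
      exact WithTop.coe_le_coe.2 (le_top : (2 : ℕ∞) ≤ ⊤)
    rw [(hTz.isSymmSndFDerivAt h2).eq (e i) z.2]
    exact (hBexp z _ _).symm
  rw [lhs] at h
  simp only [q1, q2] at h
  have q3 : ∀ a, dir (0, e i) (metricSpray L' a) z = metricN L' i a z := fun a => rfl
  simp only [q3] at h
  rw [h]; ring

/-- The transformation of the metric nonlinear connection, solved for the new coefficients. -/
theorem metricN_transform (hL : IsCoordFinsler D L) (hL' : IsCoordFinsler D' L')
    (hT : ∀ᶠ x in nhds z, ContDiffAt ℝ ∞ T x.1)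
    (hz : z ∈ D') (hTD : ∀ᶠ x in nhds z, liftMap T x ∈ D)
    (hLL' : L' =ᶠ[nhds z] L ∘ liftMap T) {S : E n → E n}
    (hST : ∀ᶠ x in nhds z, (fderiv ℝ T x.1).comp (fderiv ℝ S (T x.1)) = .id ℝ (E n))
    (hTS : (fderiv ℝ S (T z.1)).comp (fderiv ℝ T z.1) = .id ℝ (E n)) (i k : Fin n) :
    metricN L' i k z = ∑ c, fderiv ℝ S (T z.1) (e c) k *
      (∑ b, fderiv ℝ (fun x => fderiv ℝ T x (e b) c) z.1 (e i) * z.2 b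
        + ∑ a, fderiv ℝ T z.1 (e i) a * metricN L a c (liftMap T z)) := by
  have hsurj : ∀ᶠ x in nhds z, Function.Surjective (fderiv ℝ T x.1) := by
    filter_upwards [hST] with x hx
    exact fun v => ⟨fderiv ℝ S (T x.1) v, congrArg (fun A : E n →L[ℝ] E n => A v) hx⟩
  have hTz := hT.self_of_nhds
  have h1 : ∀ c, ∑ b, fderiv ℝ (fun x => fderiv ℝ T x (e b) c) z.1 (e i) * z.2 b
      = fderiv ℝ (fderiv ℝ T) z.1 (e i) z.2 c := by
    intro c
    rw [apply_eq_sum]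
    refine Finset.sum_congr rfl fun b _ => ?_
    congr 1
    have hd : DifferentiableAt ℝ (fderiv ℝ T) z.1 :=
      (fderiv_smooth hTz).differentiableAt (by simp)
    have h2 : HasFDerivAt (fun x => fderiv ℝ T x (e b)) _ z.1 :=
      hd.hasFDerivAt.clm_apply (hasFDerivAt_const (e b : E n) z.1)
    have h3 : HasFDerivAt (fun x => fderiv ℝ T x (e b) c) _ z.1 :=
      (EuclideanSpace.proj c : E n →L[ℝ] ℝ).hasFDerivAt.comp z.1 h2
    rw [h3.fderiv]
    simp
  simp only [h1, ← fderiv_metricN_liftMap hL hL' hT hsurj hz hTD hLL']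
  set N : E n := WithLp.toLp 2 fun a => metricN L' i a z with hN
  have h2 : ∀ c, ∑ a, fderiv ℝ T z.1 (e a) c * metricN L' i a z = fderiv ℝ T z.1 N c :=
    fun c => (apply_eq_sum (fderiv ℝ T z.1) N c).symm
  simp only [h2]
  rw [← apply_eq_sum, ← ContinuousLinearMap.comp_apply, hTS]
  rfl

end Transition

/-! ### Natural coordinates on the tangent bundle -/

section Coordinates

variable {n : ℕ} {M : Type*} [TopologicalSpace M] [ChartedSpace (E n) M]
  [IsManifold (𝓡 n) ∞ M]

omit [IsManifold (𝓡 n) ∞ M] in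
theorem Chart.contMDiffOn (φ : Chart n M) : ContMDiffOn (𝓡 n) (𝓡 n) ∞ φ.1 φ.1.source :=
  contMDiffOn_of_mem_maximalAtlas φ.2

omit [IsManifold (𝓡 n) ∞ M] in
theorem Chart.contMDiffOn_symm (φ : Chart n M) :
    ContMDiffOn (𝓡 n) (𝓡 n) ∞ φ.1.symm φ.1.target :=
  contMDiffOn_symm_of_mem_maximalAtlas φ.2

omit [IsManifold (𝓡 n) ∞ M] in
theorem Chart.mdifferentiable (φ : Chart n M) :
    φ.1.MDifferentiable (𝓡 n) (𝓡 n) :=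
  ⟨φ.contMDiffOn.mdifferentiableOn (by simp), φ.contMDiffOn_symm.mdifferentiableOn (by simp)⟩

theorem ofCoord_eq_tangentMap (φ : Chart n M) (z : E n × E n) :
    ofCoord φ z = tangentMap (𝓡 n) (𝓡 n) φ.1.symm ⟨z.1, z.2⟩ := rfl

theorem ofCoord_eq_tangentMapWithin (φ : Chart n M) {z : E n × E n} (hz : z.1 ∈ φ.1.target) :
    ofCoord φ z = tangentMapWithin (𝓡 n) (𝓡 n) φ.1.symm φ.1.target ⟨z.1, z.2⟩ := by
  rw [ofCoord_eq_tangentMap, tangentMapWithin_eq_tangentMap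
    (φ.1.open_target.uniqueMDiffWithinAt hz) (φ.mdifferentiable.mdifferentiableAt_symm hz)]

/-- The coordinate domain of the whole of `TM`. -/
def fullDom (φ : Chart n M) : Set (E n × E n) := {z | z.1 ∈ φ.1.target}

omit [IsManifold (𝓡 n) ∞ M] in
theorem isOpen_fullDom (φ : Chart n M) : IsOpen (fullDom φ) :=
  φ.1.open_target.preimage continuous_fst

/-- The inverse chart is smooth only on its target, so the tangent map within that open set is used;
there it coincides with the full tangent map. -/
theorem contMDiffOn_ofCoord (φ : Chart n M) :
    ContMDiffOn 𝓘(ℝ, E n × E n) (𝓡 n).tangent ∞ (ofCoord φ) (fullDom φ) := by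
  have h1 := φ.contMDiffOn_symm.contMDiffOn_tangentMapWithin (m := ∞) (by simp)
    φ.1.open_target.uniqueMDiffOn
  have h2 : ContMDiff 𝓘(ℝ, E n × E n) (𝓡 n).tangent ∞
      (fun z : E n × E n => (⟨z.1, z.2⟩ : TangentBundle (𝓡 n) (E n))) := by
    rw [modelWithCornersSelf_prod]
    exact contMDiff_tangentBundleModelSpaceHomeomorph_symm (I := 𝓡 n)
  have h3 : ContMDiffOn 𝓘(ℝ, E n × E n) (𝓡 n).tangent ∞
      (tangentMapWithin (𝓡 n) (𝓡 n) φ.1.symm φ.1.target ∘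
        fun z : E n × E n => (⟨z.1, z.2⟩ : TangentBundle (𝓡 n) (E n))) (fullDom φ) :=
    ContMDiffOn.comp (t := Bundle.TotalSpace.proj ⁻¹' φ.1.target) h1
      (h2.contMDiffOn (s := fullDom φ)) fun z hz => hz
  exact h3.congr fun z hz => ofCoord_eq_tangentMapWithin φ hz

theorem ofCoord_toCoord (φ : Chart n M) {v : TM n M} (hv : v.1 ∈ φ.1.source) :
    ofCoord φ (toCoord φ v) = v := by
  have h1 : ofCoord φ (toCoord φ v) = tangentMap (𝓡 n) (𝓡 n) φ.1.symm
      (tangentMap (𝓡 n) (𝓡 n) φ.1 v) := rfl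
  rw [h1, ← tangentMap_comp_at _ (φ.mdifferentiable.mdifferentiableAt_symm (φ.1.map_source hv))
    (φ.mdifferentiable.mdifferentiableAt hv)]
  have h2 : MDifferentiableAt (𝓡 n) (𝓡 n) (φ.1.symm ∘ φ.1) v.1 :=
    (φ.mdifferentiable.mdifferentiableAt_symm (φ.1.map_source hv)).comp v.1
      (φ.mdifferentiable.mdifferentiableAt hv)
  have hu := φ.1.open_source.uniqueMDiffWithinAt (I := 𝓡 n) hv
  rw [← tangentMapWithin_eq_tangentMap hu h2,
    tangentMapWithin_congr (f := φ.1.symm ∘ φ.1) (f₁ := id) (fun x hx => φ.1.left_inv hx) v hv,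
    tangentMapWithin_eq_tangentMap hu mdifferentiableAt_id, tangentMap_id]
  rfl

theorem toCoord_ofCoord (φ : Chart n M) {z : E n × E n} (hz : z.1 ∈ φ.1.target) :
    toCoord φ (ofCoord φ z) = z := by
  refine Prod.ext (φ.1.right_inv hz) ?_
  exact congrArg (fun A : E n →L[ℝ] E n => A z.2) (φ.mdifferentiable.comp_symm_deriv hz)

theorem isOpen_coordDom (φ : Chart n M) {U : Set (TM n M)} (hU : IsOpen U) :
    IsOpen (coordDom φ U) :=
  (contMDiffOn_ofCoord φ).continuousOn.isOpen_inter_preimage (isOpen_fullDom φ) hU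

theorem inCoord_smooth (φ : Chart n M) {U : Set (TM n M)} (hU : IsOpen U) {L : TM n M → ℝ}
    (hL : ContMDiffOn (𝓡 n).tangent 𝓘(ℝ, ℝ) ∞ L U) {z : E n × E n} (hz : z ∈ coordDom φ U) :
    ContDiffAt ℝ ∞ (inCoord φ L) z := by
  have h1 : ContMDiffOn 𝓘(ℝ, E n × E n) 𝓘(ℝ, ℝ) ∞ (inCoord φ L) (coordDom φ U) :=
    hL.comp ((contMDiffOn_ofCoord φ).mono fun z hz => hz.1) fun z hz => hz.2
  exact h1.contDiffOn.contDiffAt ((isOpen_coordDom φ hU).mem_nhds hz)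

theorem ofCoord_smul (φ : Chart n M) (z : E n × E n) (t : ℝ) :
    ofCoord φ (z.1, t • z.2) = scale t (ofCoord φ z) := by
  exact congrArg (Bundle.TotalSpace.mk (φ.1.symm z.1))
    (map_smul (mfderiv (𝓡 n) (𝓡 n) φ.1.symm z.1) t z.2)

theorem snd_ne_zero_of_ofCoord_mem_slit (φ : Chart n M) {z : E n × E n} (hz : (ofCoord φ z) ∈ slit n M) :
    z.2 ≠ 0 := by
  intro h
  apply hz
  simp only [ofCoord, h]
  exact map_zero (mfderiv (𝓡 n) (𝓡 n) φ.1.symm z.1)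

theorem ofCoord_mem_slit (φ : Chart n M) {z : E n × E n} (hz : z.1 ∈ φ.1.target)
    (h0 : z.2 ≠ 0) : ofCoord φ z ∈ slit n M := by
  intro h
  apply h0
  have h1 := congrArg Prod.snd (toCoord_ofCoord φ hz)
  rw [← h1]
  change mfderiv (𝓡 n) (𝓡 n) φ.1 (ofCoord φ z).1 (ofCoord φ z).2 = 0
  rw [h, map_zero]

/-- A pseudo-Finsler metric is one in natural coordinates. -/
theorem IsPseudoFinsler.isCoordFinsler {A : Set (TM n M)} {L : TM n M → ℝ}
    (hL : IsPseudoFinsler A L) (φ : Chart n M) :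
    IsCoordFinsler (coordDom φ A) (inCoord φ L) where
  cone :=
    { isOpen := isOpen_coordDom φ hL.domain.isOpen
      smul_mem := fun z hz t ht => ⟨hz.1, by
        rw [ofCoord_smul]; exact hL.domain.scale_mem _ hz.2 t ht⟩
      ne_zero := fun z hz => snd_ne_zero_of_ofCoord_mem_slit φ (hL.domain.subset_slit hz.2) }
  smooth := fun z hz => inCoord_smooth φ hL.domain.isOpen hL.smooth hz
  homog := fun z hz t ht => by
    simp only [inCoord]
    rw [ofCoord_smul, hL.homogeneous _ hz.2 t ht]
  det_ne := fun z hz => hL.nondegenerate φ z hz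

/-! ### Changes of charts -/

omit [IsManifold (𝓡 n) ∞ M] in
theorem transition_contDiffAt (φ ψ : Chart n M) {x : E n} (hx : x ∈ ψ.1.target)
    (hx' : ψ.1.symm x ∈ φ.1.source) : ContDiffAt ℝ ∞ (transition φ ψ) x := by
  have h1 := (φ.contMDiffOn.contMDiffAt (φ.1.open_source.mem_nhds hx')).comp x
    (ψ.contMDiffOn_symm.contMDiffAt (ψ.1.open_target.mem_nhds hx))
  exact h1.contDiffAt

omit [IsManifold (𝓡 n) ∞ M] in
theorem eventually_overlap (φ ψ : Chart n M) {x : E n} (hx : x ∈ ψ.1.target)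
    (hx' : ψ.1.symm x ∈ φ.1.source) :
    ∀ᶠ y in nhds x, y ∈ ψ.1.target ∧ ψ.1.symm y ∈ φ.1.source :=
  (ψ.1.open_target.eventually_mem hx).and ((ψ.1.continuousAt_symm hx).eventually
    (φ.1.open_source.mem_nhds hx'))

omit [IsManifold (𝓡 n) ∞ M] in
theorem transition_comp_deriv (φ ψ : Chart n M) {x : E n} (hx : x ∈ ψ.1.target)
    (hx' : ψ.1.symm x ∈ φ.1.source) :
    (fderiv ℝ (transition ψ φ) (transition φ ψ x)).comp (fderiv ℝ (transition φ ψ) x)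
      = .id ℝ (E n) := by
  have ht : transition φ ψ x ∈ φ.1.target := φ.1.map_source hx'
  have hs : φ.1.symm (transition φ ψ x) = ψ.1.symm x := φ.1.left_inv hx'
  have h1 := (transition_contDiffAt φ ψ hx hx').differentiableAt (by simp)
  have h2 := (transition_contDiffAt ψ φ ht (by rw [hs]; exact ψ.1.map_target hx)).differentiableAt
    (by simp)
  rw [← fderiv_comp x h2 h1]
  have h3 : transition ψ φ ∘ transition φ ψ =ᶠ[nhds x] id := by
    filter_upwards [eventually_overlap φ ψ hx hx'] with y hy
    simp only [Function.comp_apply, transition, id]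
    rw [φ.1.left_inv hy.2, ψ.1.right_inv hy.1]
  rw [h3.fderiv_eq, fderiv_id]

/-- The chain rule identifies the lift of the transition map, on which the coordinate computations
rest, with the change of natural coordinates on `TM`. -/
theorem liftMap_transition (φ ψ : Chart n M) {z : E n × E n} (hz : z.1 ∈ ψ.1.target)
    (hz' : ψ.1.symm z.1 ∈ φ.1.source) :
    liftMap (transition φ ψ) z = toCoord φ (ofCoord ψ z) := by
  refine Prod.ext rfl ?_
  have h1 : mfderiv (𝓡 n) (𝓡 n) (φ.1 ∘ ψ.1.symm) z.1 = _ :=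
    mfderiv_comp z.1 (φ.mdifferentiable.mdifferentiableAt hz')
      (ψ.mdifferentiable.mdifferentiableAt_symm hz)
  have h2 : fderiv ℝ (transition φ ψ) z.1 = mfderiv (𝓡 n) (𝓡 n) (φ.1 ∘ ψ.1.symm) z.1 :=
    mfderiv_eq_fderiv.symm
  simp only [liftMap]
  rw [h2, h1]
  rfl

theorem ofCoord_liftMap_transition (φ ψ : Chart n M) {z : E n × E n} (hz : z.1 ∈ ψ.1.target)
    (hz' : ψ.1.symm z.1 ∈ φ.1.source) :
    ofCoord φ (liftMap (transition φ ψ) z) = ofCoord ψ z := by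
  rw [liftMap_transition φ ψ hz hz']
  exact ofCoord_toCoord φ hz'

/-- The coefficients of the metric nonlinear connection transform as such. -/
theorem metricN_cocycle {A : Set (TM n M)} {L : TM n M → ℝ} (hL : IsPseudoFinsler A L)
    (φ ψ : Chart n M) {z : E n × E n} (hz : z ∈ coordDom ψ A)
    (hz' : ψ.1.symm z.1 ∈ φ.1.source) (i k : Fin n) :
    liftMap (transition φ ψ) z ∈ coordDom φ A ∧
    metricN (inCoord ψ L) i k z =
      ∑ c, fderiv ℝ (transition ψ φ) (transition φ ψ z.1) (e c) k *
        (∑ b, fderiv ℝ (fun x => fderiv ℝ (transition φ ψ) x (e b) c) z.1 (e i) * z.2 b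
          + ∑ a, fderiv ℝ (transition φ ψ) z.1 (e i) a *
              metricN (inCoord φ L) a c (liftMap (transition φ ψ) z)) := by
  have hov : ∀ᶠ x in nhds z, x.1 ∈ ψ.1.target ∧ ψ.1.symm x.1 ∈ φ.1.source :=
    continuous_fst.continuousAt.eventually (eventually_overlap φ ψ hz.1 hz')
  have hmem : ∀ᶠ x in nhds z, liftMap (transition φ ψ) x ∈ coordDom φ A := by
    filter_upwards [hov, (isOpen_coordDom ψ hL.domain.isOpen).mem_nhds hz] with x hx hxA
    refine ⟨φ.1.map_source hx.2, ?_⟩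
    rw [ofCoord_liftMap_transition φ ψ hx.1 hx.2]
    exact hxA.2
  refine ⟨hmem.self_of_nhds, ?_⟩
  refine metricN_transform (hL.isCoordFinsler φ) (hL.isCoordFinsler ψ) ?_ hz hmem ?_ ?_
    (transition_comp_deriv φ ψ hz.1 hz') i k
  · filter_upwards [hov] with x hx using transition_contDiffAt φ ψ hx.1 hx.2
  · filter_upwards [hov] with x hx
    simp only [inCoord, Function.comp_apply]
    rw [ofCoord_liftMap_transition φ ψ hx.1 hx.2]
  · filter_upwards [hov] with x hx
    have hs : φ.1.symm (transition φ ψ x.1) = ψ.1.symm x.1 := φ.1.left_inv hx.2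
    have := transition_comp_deriv ψ φ (x := transition φ ψ x.1) (φ.1.map_source hx.2)
      (by rw [hs]; exact ψ.1.map_target hx.1)
    have h2 : transition ψ φ (transition φ ψ x.1) = x.1 := by
      change ψ.1 (φ.1.symm (transition φ ψ x.1)) = x.1
      rw [hs]; exact ψ.1.right_inv hx.1
    rwa [h2] at this

end Coordinates

/-! ### The metric nonlinear connection -/

section Main

variable {n : ℕ} {M : Type*} [TopologicalSpace M] [ChartedSpace (E n) M]
  [IsManifold (𝓡 n) ∞ M] {A : Set (TM n M)} {L : TM n M → ℝ}

/-- The metric nonlinear connection. -/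
noncomputable def metricConnection (hL : IsPseudoFinsler A L) : NonlinearConnection A where
  coeff φ i k := (coordDom φ A).indicator (metricN (inCoord φ L) i k)
  smooth φ i k := by
    have h := hL.isCoordFinsler φ
    refine ContDiffOn.congr (f := metricN (inCoord φ L) i k) (fun z hz => ?_)
      fun z hz => Set.indicator_of_mem hz _
    exact (metricN_smooth (h.smooth z hz) (h.det_ne z hz) i k).contDiffWithinAt
  homogeneous φ i k z hz t ht := by
    have h := hL.isCoordFinsler φ
    rw [Set.indicator_of_mem hz, Set.indicator_of_mem (h.cone.smul_mem z hz t ht),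
      h.metricN_homog i k z hz t ht, pow_one]
  cocycle φ ψ z hz hz' i k := by
    obtain ⟨hmem, h⟩ := metricN_cocycle hL φ ψ hz hz' i k
    rw [Set.indicator_of_mem hz, h]
    have h2 : ∀ a c, (coordDom φ A).indicator (metricN (inCoord φ L) a c)
        (transition φ ψ z.1, fderiv ℝ (transition φ ψ) z.1 z.2)
        = metricN (inCoord φ L) a c (liftMap (transition φ ψ) z) := fun a c =>
      Set.indicator_of_mem hmem _
    simp only [h2]
  off φ i k z hz := Set.indicator_of_notMem hz _

theorem metricConnection_isMetric (hL : IsPseudoFinsler A L) :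
    (metricConnection hL).IsMetric L := fun _ _ hz _ _ => Set.indicator_of_mem hz _

theorem metricConnection_isSymmetric (hL : IsPseudoFinsler A L) :
    (metricConnection hL).IsSymmetric := by
  intro φ z hz i j k
  have h := hL.isCoordFinsler φ
  have h1 : ∀ i k, Set.EqOn ((metricConnection hL).coeff φ i k) (metricN (inCoord φ L) i k)
      (coordDom φ A) := fun i k z hz => Set.indicator_of_mem hz _
  have h2 : ∀ i j, dy j ((metricConnection hL).coeff φ i k) z
      = dy j (metricN (inCoord φ L) i k) z := fun i j =>
    dir_eqOn h.cone.isOpen (h1 i k) _ hz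
  rw [h2, h2, h.dy_metricN_comm hz, sub_self]

theorem metricConnection_isSolution (hL : IsPseudoFinsler A L) (hC : MeanCartanVanishes A L) :
    (metricConnection hL).IsSolution L := by
  intro φ z hz i j
  refine (hL.isCoordFinsler φ).affineLHS_zero (hC φ) hz (fun x hx i k => ?_) i j
  rw [NonlinearConnection.diffMetric, metricConnection_isMetric hL φ x hx, sub_self]

/-- Extensions of `L` to boundary points, in natural coordinates. -/
theorem IsProper.exists_extension (hL : IsProper A L) (φ : Chart n M) {z : E n × E n}
    (hz : z.1 ∈ φ.1.target) (hcl : ofCoord φ z ∈ slitClosure A) (hA : ofCoord φ z ∉ A) :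
    ∃ (W : Set (E n × E n)) (L' : E n × E n → ℝ), IsOpen W ∧ z ∈ W ∧
      ContDiffAt ℝ ∞ L' z ∧ (gMat L' z).det ≠ 0 ∧ L' z = 0 ∧
      Set.EqOn (inCoord φ L) L' (W ∩ coordDom φ A) := by
  obtain ⟨U, L', hU, hzU, hL's, hLL', hL'0, hdet⟩ := hL.boundary _ ⟨hcl, hA⟩
  refine ⟨coordDom φ U, inCoord φ L', isOpen_coordDom φ hU, ⟨hz, hzU⟩,
    inCoord_smooth φ hU hL's ⟨hz, hzU⟩, ?_, hL'0, ?_⟩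
  · have := hdet φ (φ.1.map_target hz)
    rwa [toCoord_ofCoord φ hz] at this
  · intro x hx
    exact (hLL' ⟨hx.1.2, hx.2.2⟩).symm

/-- Near a boundary point the extension `L'` keeps a nondegenerate fundamental tensor, so its metric
coefficients are smooth there. On the open set where `L' = L` they agree with those of `L`, since
they involve only derivatives. -/
theorem metricConnection_extendsSmoothly (hL : IsProper A L) :
    (metricConnection hL.toIsPseudoFinsler).ExtendsSmoothly := by
  intro φ v hv hvφ i k
  have h := hL.toIsPseudoFinsler.isCoordFinsler φ
  have hz : (toCoord φ v).1 ∈ φ.1.target := φ.1.map_source hvφ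
  have hvz := ofCoord_toCoord φ hvφ
  have hN : Set.EqOn (metricN (inCoord φ L) i k)
      ((metricConnection hL.toIsPseudoFinsler).coeff φ i k) (coordDom φ A) := fun z hz =>
    (metricConnection_isMetric hL.toIsPseudoFinsler φ z hz i k).symm
  by_cases hA : v ∈ A
  · refine ⟨coordDom φ A, metricN (inCoord φ L) i k, h.cone.isOpen, ⟨hz, by rwa [hvz]⟩,
      fun z hz => ?_, hN.mono Set.inter_subset_right⟩
    exact (metricN_smooth (h.smooth z hz) (h.det_ne z hz) i k).contDiffWithinAt
  · obtain ⟨U, L', hU, hvU, hL's, hLL', hL'0, hdet⟩ := hL.boundary v ⟨hv, hA⟩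
    have hzU : toCoord φ v ∈ coordDom φ U := ⟨hz, by rwa [hvz]⟩
    have hdet' : ∀ᶠ x in nhds (toCoord φ v), (gMat (inCoord φ L') x).det ≠ 0 :=
      det_eventually_ne (inCoord_smooth φ hU hL's hzU) (hdet φ hvφ)
    obtain ⟨V, hVdet, hV, hzV⟩ := eventually_nhds_iff.1 hdet'
    refine ⟨coordDom φ U ∩ V, metricN (inCoord φ L') i k, (isOpen_coordDom φ hU).inter hV,
      ⟨hzU, hzV⟩, fun x hx => ?_, ?_⟩
    · exact (metricN_smooth (inCoord_smooth φ hU hL's hx.1) (hVdet x hx.2) i k).contDiffWithinAt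
    · have h1 : Set.EqOn (inCoord φ L') (inCoord φ L) (coordDom φ U ∩ coordDom φ A) :=
        fun x hx => hLL' ⟨hx.1.2, hx.2.2⟩
      intro x hx
      have hx' : x ∈ coordDom φ U ∩ coordDom φ A := ⟨hx.1.1, hx.2⟩
      rw [metricN_eqOn ((isOpen_coordDom φ hU).inter h.cone.isOpen) h1 i k hx']
      exact hN hx.2

/-- Uniqueness of the proper symmetric solution. -/
theorem eq_metricConnection (hn : 3 ≤ n) (hL : IsLorentzFinsler A L)
    (hC : MeanCartanVanishes A L) {N : NonlinearConnection A} (hN : N.IsSolution L)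
    (hNsym : N.IsSymmetric) (hNext : N.ExtendsSmoothly) :
    N = metricConnection hL.toIsPseudoFinsler := by
  ext φ i k z
  have h := hL.toIsPseudoFinsler.isCoordFinsler φ
  by_cases hz : z ∈ coordDom φ A
  swap
  · rw [N.off φ i k z hz, NonlinearConnection.off _ φ i k z hz]
  rw [metricConnection_isMetric hL.toIsPseudoFinsler φ z hz]
  refine h.J_eq_zero hn (N := N.coeff φ) (fun x hx => hL.pos _ hx.2)
    (fun x hx => hL.lorentzian φ x hx) (hC φ)
    (fun x hx i k => (N.smooth φ i k).contDiffAt (h.cone.isOpen.mem_nhds hx))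
    (fun i k x hx t ht => by rw [pow_one]; exact N.homogeneous φ i k x hx t ht)
    (fun x hx i j k => sub_eq_zero.1 (hNsym φ x hx i j k)) (hN φ) ?_ hz i k
  rintro p hp hpcl hp0 ⟨y, hy⟩
  -- The boundary point lies over the same base point as some element of the domain, so the chart
  -- covers it and it represents a point of the closure of `A` in `TM ∖ 0`.
  have hpt : p.1 ∈ φ.1.target := hy.1
  have hcl : ofCoord φ p ∈ slitClosure A := by
    refine ⟨?_, ofCoord_mem_slit φ hpt hp0⟩
    have hc : ContinuousAt (ofCoord φ) p :=
      (contMDiffOn_ofCoord φ).continuousOn.continuousAt ((isOpen_fullDom φ).mem_nhds hpt)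
    exact hc.continuousWithinAt.mem_closure hpcl fun x hx => hx.2
  obtain ⟨W, L', hW, hpW, hL's, hdet, hL'0, hLL'⟩ :=
    hL.toIsProper.exists_extension φ hpt hcl fun hA => hp ⟨hpt, hA⟩
  -- Only the trace must extend, so the diagonal coefficients suffice; the finitely many
  -- neighbourhoods are intersected.
  have hext := fun a => hNext φ _ hcl (φ.1.map_target hpt) a a
  rw [toCoord_ofCoord φ hpt] at hext
  choose U N' hU hpU hN's hNN' using hext
  refine ⟨W ∩ ⋂ a, U a, L', N', hW.inter (isOpen_iInter_of_finite hU),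
    ⟨hpW, Set.mem_iInter.2 hpU⟩, hL's, fun a => (hN's a).contDiffAt ((hU a).mem_nhds (hpU a)),
    hdet, hL'0, fun x hx => hLL' ⟨hx.1.1, hx.2⟩, fun a x hx => ?_⟩
  exact (hNN' a ⟨Set.mem_iInter.1 hx.1.2 a, hx.2⟩).symm

end Main

end FinslerAffine

theorem mainTheorem8 {n : ℕ} (hn : 3 ≤ n) {M : Type*} [TopologicalSpace M] [T2Space M]
    [SecondCountableTopology M] [ConnectedSpace M] [ChartedSpace (FinslerAffine.E n) M]
    [IsManifold (𝓡 n) ∞ M] (A : Set (FinslerAffine.TM n M)) (L : FinslerAffine.TM n M → ℝ)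
    (hL : FinslerAffine.IsLorentzFinsler A L) (hC : FinslerAffine.MeanCartanVanishes A L) :
    ∃ N : FinslerAffine.NonlinearConnection A, N.IsMetric L ∧
      FinslerAffine.SolSym A L ∩ FinslerAffine.SolProper A L = {N} := by
  refine ⟨FinslerAffine.metricConnection hL.toIsPseudoFinsler,
    FinslerAffine.metricConnection_isMetric _, Set.eq_singleton_iff_unique_mem.2 ⟨?_, ?_⟩⟩
  · have h := FinslerAffine.metricConnection_isSolution hL.toIsPseudoFinsler hC
    exact ⟨⟨h, FinslerAffine.metricConnection_isSymmetric _⟩,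
      ⟨h, FinslerAffine.metricConnection_extendsSmoothly hL.toIsProper⟩⟩
  · rintro N ⟨⟨h1, h2⟩, ⟨-, h3⟩⟩
    exact FinslerAffine.eq_metricConnection hn hL hC h1 h2 h3
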